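/- **Conventions.** $\tau$ is a vocabulary (with finitary predicates and function symbols), $K$ is a class of $\tau$-models, $K=K_\nu$ means that all models in $K$ have cardinality $\nu$, and $\dot{\mathbb I}(K)$ is the number of isomorphism types of models in $K$. A formula $\varphi(\bar x,\bar y)$ in the vocabulary $\tau$, with $\ell g(\bar x)=\ell g(\bar y)=\partial$ (possibly infinite), may belong to any logic: only its satisfaction relation $M\models\varphi[\bar a,\bar b]$ ($M$ a $\tau$-model, $\bar a,\bar b\in{}^\partial M$), which is preserved by isomorphisms, is used. Put $\psi(\bar x,\bar y)=\varphi(\bar y,\bar x)$. For a linear order $I$, $J\subseteq I$ and $\bar a_s\in{}^\partial M$ $(s\in I)$, say that $J$ *determines* $\bar c\in{}^\partial M$ if for all $s,t\in I$ with the same quantifier-free type over $J$ in $I$ we have $M\models\varphi[\bar a_s,\bar c]\equiv\varphi[\bar a_t,\bar c]$ and $M\models\psi[\bar a_s,\bar c]\equiv\psi[\bar a_t,\bar c]$. * $\langle\bar a_s:s\in I\rangle$ is *weakly $(\kappa,\varphi)$-skeleton like* inside $M$ if $\varphi$ is asymmetric in $M$; $M\models\varphi[\bar a_s,\bar a_t]$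 iff $s<t$; and every $\bar c\in{}^\partial M$ is determined by some $J\subseteq I$ with $|J|<\kappa$. * $\langle\bar a_s:s\in I\rangle$ is *weakly $(\kappa,\mu,{<}\theta,\varphi)$-skeleton like* inside $M$ if $M\models\varphi[\bar a_s,\bar a_t]$ iff $s<t$; every $\bar c\in{}^\partial M$ is determined by some $J\subseteq I$ with $|J|<\kappa$; and for every $A\subseteq M$ with $|A|<\mu$ there is $J\subseteq I$ with $|J|<\theta$ which determines every $\bar c\in{}^\partial A$. For $\mu=\theta$ we omit $\mu$. * For $A\subseteq M$, $\mathbf S^\partial_{\{\varphi,\psi\}}(A,M)$ is the set of the types $\mathrm{tp}_{\{\varphi,\psi\}}(\bar c,A,M)$, $\bar c\in{}^\partial M$, and for $\bar b_i\in{}^\partial M$ $(i<\kappa)$, $\mathrm{Av}(\langle\bar b_i:i<\kappa\rangle,A,M)$ is the set of those $\vartheta(\bar x,\bar a)^{\mathbf t}$, with $\vartheta\in\{\varphi,\psi\}$, $\bar a\in{}^\partial A$ and $\mathbf t$ a truth value, which $\bar b_i$ satisfies for all but a bounded set of $i<\kappa$; it is *well defined* if for all $\vartheta,\bar a$ it contains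 $\vartheta(\bar x,\bar a)^{\mathbf t}$ for some $\mathbf t$. * $M$ has *few types for $(\mu,\nu)$* if for every $A\subseteq M$ with $|A|<\nu$, either $|\mathbf S^\partial_{\{\varphi,\psi\}}(A,M)|<\mu$, or at least there are fewer than $\mu$ sets of the form $\mathrm{Av}(\langle\bar b_i:i<\kappa\rangle,A,M)$ with all $\bar b_i\in{}^\partial A$ that are well defined and realized in $M$. **Theorem 3.11.** Let $\partial<\kappa<\lambda$ be cardinals, $\kappa$ regular, $K$ a class of $\tau$-models, and $\varphi(\bar x,\bar y)$ a formula in the vocabulary $\tau$ with $\ell g(\bar x)=\ell g(\bar y)=\partial$. Consider the assumption $(*)$ $K=K_\lambda$, and for every linear order $I$ of cardinality $\lambda$ there are $M_I\in K$ and a sequence $\langle\bar a_t:t\in I\rangle$ which is weakly $(\kappa,\varphi)$-skeleton like inside $M_I$. Suppose that at least one of the following holds. * **(a)** $(*)$ and $\lambda=\lambda^\partial$. * **(b)** $(*)$ and $\lambda^\kappa<2^\lambda$. * **(c)** $K=K_\lambda$, $\lambda^\partial<2^\lambda$, $\mathrm{cf}(\lambda)>\partial$, and for every linear order $J$ of cardinality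 $\lambda$ there are $M_J\in K$ and a weakly $(\kappa,{<}\lambda,\varphi)$-skeleton like sequence $\langle\bar a_s:s\in J\rangle$ inside $M_J$. * **(d)** There are cardinals $\lambda(0)\le\lambda(1)\le\lambda\le\lambda(3)<2^\lambda$ and $\mu(0)\le\mu(1)\le2^\lambda$ with $\lambda(1),\mu(1)$ regular such that $K=K_{\lambda(3)}$; $\lambda^\partial<2^\lambda$; for every linear order $J$ of cardinality $\lambda$ there is $M_J\in K$ which has few types for $(\mu(0),\lambda(0))$ and inside which there is a weakly $(\kappa,\lambda(0),{<}\lambda(1),\varphi)$-skeleton like sequence indexed by $J$; and whenever $\mathbf I_i\subseteq{}^\partial\lambda(3)$, $|\mathbf I_i|=\lambda$ for $i<\mu(1)$, there is $B\subseteq\lambda(3)$ with $|B|<\lambda(0)$ and $|\{i:|\mathbf I_i\cap{}^\partial B|\ge\kappa\}|\ge\mu(0)$. * **(e)** There are an index set $\{\epsilon:\epsilon<\epsilon(*)\}$ and cardinals $\lambda_{0,\epsilon}\le\lambda_{1,\epsilon}\le\lambda\le\lambda_3$ and $\mu_{0,\epsilon}\le\mu_1\le2^\lambda$ with $\mu_1$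 regular such that $K=K_{\lambda_3}$; $\lambda^\partial<2^\lambda$; for every linear order $J$ of cardinality $\lambda$ there are $M_J\in K$ and a sequence $\langle\bar a_s:s\in J\rangle$ such that for every $\epsilon<\epsilon(*)$ the sequence is weakly $(\kappa,\lambda_{0,\epsilon},{<}\lambda_{1,\epsilon},\varphi)$-skeleton like inside $M_J$ and $M_J$ has few types for $(\mu_{0,\epsilon},\lambda_{0,\epsilon})$; and there are functions $h_\alpha:\lambda\to\{\theta:\theta\text{ regular},\ \kappa\le\theta\le\lambda\}$ for $\alpha<2^\lambda$ such that whenever $S\subseteq2^\lambda$, $|S|\ge\mu_1$ and $f_\alpha:\lambda\to{}^\partial(\lambda_3)$ for $\alpha\in S$, there are $\epsilon<\epsilon(*)$ and $B\subseteq\lambda_3$ with $|B|<\lambda_{0,\epsilon}$ for which at least $\mu_{0,\epsilon}$ many $\alpha\in S$ satisfy: the set $\{\zeta<\lambda:f_\alpha(\zeta)\in{}^\partial B\}$ has a limit point $\delta<\lambda$ (that is, $\delta>0$ and the set is unbounded in $\delta$) with $\mathrm{cf}(\delta)=\kappa$ and $h_\alpha(\delta)\ge\lambda_{1,\epsilon}$.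 * **(f)** $(*)$, and for some $\mu<\lambda$ with $2^{\mu+\partial}<2^\lambda$ there is a linear order of cardinality $\mu$ with at least $\lambda$ Dedekind cuts each of which has upper and lower cofinality $\ge\kappa$. * **(g)** $(*)$, and there is a family $\mathcal P$ of subsets of cardinality $\kappa$ of ${}^\partial\lambda$ with $|\mathcal P|<2^\lambda$ such that every $X\subseteq{}^\partial\lambda$ of cardinality $\lambda$ includes a member of $\mathcal P$. Then there are at least $2^\lambda$ pairwise non-isomorphic models in $K$, i.e. $\dot{\mathbb I}(K)\ge2^\lambda$. Moreover $\dot{\mathbb I}(K)=2^\lambda$ whenever the trivial upper bound allows it, i.e. whenever $2^{\nu+|\tau|}=2^\lambda$ where $K=K_\nu$ ($\nu=\lambda$ in (a), (b), (c), (f), (g), $\nu=\lambda(3)$ in (d), $\nu=\lambda_3$ in (e)); in particular if $K=K_\lambda$ and $|\tau|\le\lambda$. -/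

import Mathlib

open Cardinal

universe u v w

namespace Skel

/-- A `τ`-model, i.e. a structure for the language `L` with its carrier in `Type u`. -/
abbrev Model (L : FirstOrder.Language.{v, w}) : Type (max (u + 1) v w) :=
  CategoryTheory.Bundled.{u} L.Structure

/-- A formula `φ(x̄, ȳ)` in the vocabulary `L`, in an arbitrary logic, where `x̄` and `ȳ` are both
indexed by `ι` (so `lg x̄ = lg ȳ = #ι`, possibly infinite).  It is given by its satisfaction relation
`M ⊨ φ[ā, b̄]` in all `L`-models, which has to be preserved by isomorphisms of `L`-models. -/
structure Formula (L : FirstOrder.Language.{v, w}) (ι : Type u) where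
  Sat : ∀ M : Model.{u} L, (ι → M) → (ι → M) → Prop
  sat_equiv : ∀ (M N : Model.{u} L) (e : L.Equiv M N) (a b : ι → M),
    Sat M a b ↔ Sat N (fun i => e (a i)) (fun i => e (b i))

/-- The number `İ(K)` of models in the class `K` up to isomorphism. -/
noncomputable def numModels {L : FirstOrder.Language.{v, w}} (K : Set (Model.{u} L)) :
    Cardinal.{max (u + 1) v w} :=
  #((Quotient.mk (FirstOrder.Language.equivSetoid (L := L))) '' K)

/-- `K = K_ν`: all models in the class `K` have cardinality `ν`. -/
def AllOfCard {L : FirstOrder.Language.{v, w}} (K : Set (Model.{u} L)) (ν : Cardinal.{u}) : Prop :=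
  ∀ M ∈ K, #M = ν

/-- `tp_qf(s, J, I) = tp_qf(t, J, I)` in the linear order `I`: the elements `s` and `t` have the same
quantifier-free type over the set `J`. -/
def SameQfType {I : Type u} [LinearOrder I] (J : Set I) (s t : I) : Prop :=
  ∀ j ∈ J, (s < j ↔ t < j) ∧ (s = j ↔ t = j) ∧ (j < s ↔ j < t)

section

variable {L : FirstOrder.Language.{v, w}} {ι : Type u} (φ : Formula L ι) (M : Model.{u} L)

/-- `φ` is asymmetric in `M`. -/
def Asymmetric : Prop := ∀ a b : ι → M, φ.Sat M a b → ¬ φ.Sat M b a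

/-- Satisfaction of the two formulas `φ(x̄, c̄)` (for `k = true`) and `ψ(x̄, c̄) = φ(c̄, x̄)`
(for `k = false`) by the sequence `a`. -/
def SatInst (k : Bool) (a c : ι → M) : Prop :=
  bif k then φ.Sat M a c else φ.Sat M c a

/-- The set `J ⊆ I` determines the truth value of `φ(ā_s, c̄)` and of `ψ(ā_s, c̄)`: it depends only
on the quantifier-free type of `s` over `J` in `I`. -/
def Determines {I : Type u} [LinearOrder I] (a : I → ι → M) (J : Set I) (c : ι → M) : Prop :=
  ∀ (k : Bool) (s t : I), SameQfType J s t → (SatInst φ M k (a s) c ↔ SatInst φ M k (a t) c)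

/-- `⟨ā_s : s ∈ I⟩` is weakly `(κ, φ(x̄, ȳ))`-skeleton like inside `M`. -/
def WeaklySkeletonLike (κ : Cardinal.{u}) {I : Type u} [LinearOrder I] (a : I → ι → M) : Prop :=
  Asymmetric φ M ∧
  (∀ c : ι → M, ∃ J : Set I, #J < κ ∧ Determines φ M a J c) ∧
  (∀ s t : I, φ.Sat M (a s) (a t) ↔ s < t)

/-- `⟨ā_s : s ∈ I⟩` is weakly `(κ, μ, <θ, φ(x̄, ȳ))`-skeleton like inside `M`. -/
def WeaklySkeletonLike₃ (κ μ θ : Cardinal.{u}) {I : Type u} [LinearOrder I]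
    (a : I → ι → M) : Prop :=
  (∀ s t : I, φ.Sat M (a s) (a t) ↔ s < t) ∧
  (∀ c : ι → M, ∃ J : Set I, #J < κ ∧ Determines φ M a J c) ∧
  (∀ A : Set M, #A < μ → ∃ J : Set I, #J < θ ∧
    ∀ c : ι → M, (∀ i, c i ∈ A) → Determines φ M a J c)

/-- The instances `φ(x̄, c̄)^t`, `ψ(x̄, c̄)^t` with parameters `c̄` from `A` and a truth value `t`:
the formula is chosen by the first component. -/
abbrev SignedInst (ι : Type u) {M : Model.{u} L} (A : Set M) : Type u := Bool × (ι → A) × Bool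

/-- Satisfaction of a signed instance by the sequence `a`. -/
def SatSigned {A : Set M} (a : ι → M) (p : SignedInst ι A) : Prop :=
  SatInst φ M p.1 a (fun i => (p.2.1 i : M)) ↔ p.2.2 = true

/-- `tp_{φ,ψ}(ā, A, M)`. -/
def typeOver (A : Set M) (a : ι → M) : Set (SignedInst ι A) := {p | SatSigned φ M a p}

/-- `𝐒^∂_{φ,ψ}(A, M)`: the set of `{φ,ψ}`-types over `A` of sequences from `M`. -/
def typesOver (A : Set M) : Set (Set (SignedInst ι A)) := Set.range (typeOver φ M A)

/-- `Av_{φ,ψ}(⟨b̄_i : i < κ⟩, A, M)`: the signed instances which `b̄_i` satisfies for all but a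
bounded set of `i < κ`. -/
def average {κ : Cardinal.{u}} (A : Set M) (b : κ.ord.ToType → ι → M) : Set (SignedInst ι A) :=
  {p | ∃ i₀, ∀ i, i₀ ≤ i → SatSigned φ M (b i) p}

/-- The average is well defined: every instance gets an eventual truth value. -/
def AverageDefined {κ : Cardinal.{u}} (A : Set M) (b : κ.ord.ToType → ι → M) : Prop :=
  ∀ (k : Bool) (c : ι → A), ∃ t : Bool, (k, c, t) ∈ average φ M A b

/-- The set of averages over `A` of sequences `⟨b̄_i : i < κ⟩` of `ι`-sequences from `A` which are
well defined and realized in `M`. -/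
def realizedAverages (κ : Cardinal.{u}) (A : Set M) : Set (Set (SignedInst ι A)) :=
  {p | ∃ b : κ.ord.ToType → ι → M, (∀ i j, b i j ∈ A) ∧ AverageDefined φ M A b ∧
    p = average φ M A b ∧ ∃ c : ι → M, ∀ q ∈ p, SatSigned φ M c q}

/-- Over every set `A ⊆ M` with `|A| < ν` there are fewer than `μ` types, or at least fewer than `μ`
well defined realized averages of `κ`-sequences from `A`. -/
def FewTypes (κ μ ν : Cardinal.{u}) : Prop :=
  ∀ A : Set M, #A < ν → #(typesOver φ M A) < μ ∨ #(realizedAverages φ M κ A) < μ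

end

section

variable {L : FirstOrder.Language.{v, w}} {ι : Type u} (φ : Formula L ι) (K : Set (Model.{u} L))
  (κ lam : Cardinal.{u})

/-- The basic assumption: `K = K_λ`, and every linear order of cardinality `λ` indexes a weakly
`(κ, φ)`-skeleton like sequence inside some model in `K`. -/
def Star : Prop :=
  AllOfCard K lam ∧
  ∀ (I : Type u) [LinearOrder I], #I = lam →
    ∃ M ∈ K, ∃ a : I → ι → M, WeaklySkeletonLike φ M κ a

/-- The variant assumption with `λ^∂ < 2^λ`, `cf λ > ∂` and weakly `(κ, <λ, φ)`-skeleton like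
sequences. -/
def CondC : Prop :=
  AllOfCard K lam ∧
  lam ^ #ι < 2 ^ lam ∧ #ι < lam.ord.cof ∧
  ∀ (J : Type u) [LinearOrder J], #J = lam →
    ∃ M ∈ K, ∃ a : J → ι → M, WeaklySkeletonLike₃ φ M κ lam lam a

/-- The variant assumption with few types over small sets and a covering property of families of
subsets of `^∂λ(3)`. The cardinal `λ(3)` is represented by the set `lam3.out`, and `μ(1)` by the
index set `mu1.out`. -/
def CondD : Prop :=
  ∃ lam0 lam1 lam3 mu0 mu1 : Cardinal.{u},
    lam0 ≤ lam1 ∧ lam1 ≤ lam ∧ lam ≤ lam3 ∧ lam3 < 2 ^ lam ∧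
    mu0 ≤ mu1 ∧ mu1 ≤ 2 ^ lam ∧ lam1.IsRegular ∧ mu1.IsRegular ∧
    AllOfCard K lam3 ∧
    lam ^ #ι < 2 ^ lam ∧
    (∀ (J : Type u) [LinearOrder J], #J = lam →
      ∃ M ∈ K, (∃ a : J → ι → M, WeaklySkeletonLike₃ φ M κ lam0 lam1 a) ∧
        FewTypes φ M κ mu0 lam0) ∧
    (∀ F : mu1.out → Set (ι → lam3.out), (∀ i, #(F i) = lam) →
      ∃ B : Set lam3.out, #B < lam0 ∧
        mu0 ≤ #{i : mu1.out | κ ≤ #{f : ι → lam3.out | f ∈ F i ∧ ∀ j, f j ∈ B}})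

/-- `δ` is a limit point of the set `X` in the linear order. -/
def IsLimitPoint {I : Type u} [LinearOrder I] (X : Set I) (δ : I) : Prop :=
  (∃ γ, γ < δ) ∧ ∀ γ < δ, ∃ ζ ∈ X, γ < ζ ∧ ζ < δ

/-- The variant assumption with parameters indexed by `ε < ε(∗)` and functions `h_α`. The index set of the `ε < ε(∗)` is `E`, the ordinals below `λ` form
`lam.ord.ToType`, and `2^λ` is represented by the index set `(2 ^ lam).out`. -/
def CondE : Prop :=
  ∃ (E : Type u) (lam0 lam1 mu0 : E → Cardinal.{u}) (lam3 mu1 : Cardinal.{u}),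
    (∀ ε, lam0 ε ≤ lam1 ε ∧ lam1 ε ≤ lam ∧ mu0 ε ≤ mu1) ∧
    lam ≤ lam3 ∧ mu1 ≤ 2 ^ lam ∧ mu1.IsRegular ∧
    AllOfCard K lam3 ∧
    lam ^ #ι < 2 ^ lam ∧
    (∀ (J : Type u) [LinearOrder J], #J = lam →
      ∃ M ∈ K, (∃ a : J → ι → M, ∀ ε, WeaklySkeletonLike₃ φ M κ (lam0 ε) (lam1 ε) a) ∧
        ∀ ε, FewTypes φ M κ (mu0 ε) (lam0 ε)) ∧
    (∃ h : (2 ^ lam : Cardinal.{u}).out → lam.ord.ToType → Cardinal.{u},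
      (∀ α ζ, (h α ζ).IsRegular ∧ κ ≤ h α ζ ∧ h α ζ ≤ lam) ∧
      ∀ S : Set (2 ^ lam : Cardinal.{u}).out, mu1 ≤ #S →
        ∀ f : S → lam.ord.ToType → ι → lam3.out,
          ∃ (ε : E) (B : Set lam3.out), #B < lam0 ε ∧
            mu0 ε ≤ #{α : S | ∃ δ : lam.ord.ToType,
              IsLimitPoint {ζ | ∀ j, f α ζ j ∈ B} δ ∧
              Order.cof (Set.Iio δ) = κ ∧ lam1 ε ≤ h α δ})

/-- There is a linear order with few elements and many Dedekind cuts of large cofinalities; `d` is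
the length `∂` of the sequences. A Dedekind cut is given by its lower
part `C`. -/
def CondF (d κ lam : Cardinal.{u}) : Prop :=
  ∃ (X : Type u) (_ : LinearOrder X), #X < lam ∧
    lam ≤ #{C : Set X | IsLowerSet C ∧ κ ≤ Order.cof C ∧ κ ≤ Order.cof (↥Cᶜ)ᵒᵈ} ∧
    (2 : Cardinal.{u}) ^ (#X + d) < 2 ^ lam

/-- There is a small family of sets of size `κ` which is dense for the subsets of `^∂λ` of size
`λ`, where `^∂λ` is represented as `ι → lam.out`. -/
def CondG (ι : Type u) (κ lam : Cardinal.{u}) : Prop :=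
  ∃ P : Set (Set (ι → lam.out)), #P < 2 ^ lam ∧ (∀ p ∈ P, #p = κ) ∧
    ∀ X : Set (ι → lam.out), #X = lam → ∃ p ∈ P, p ⊆ X

end

end Skel

/-!
Why there are `2 ^ lam` models. Each of `2 ^ lam` codes `w` is turned into linear orders whose
cuts remember `w`. If there were fewer than `2 ^ lam` isomorphism types, then many of the skeleton
sequences indexed by these orders could be moved into a single model, and a counting argument that
depends on the case finds two of them, with different codes, which have a common average at some
cut. This is impossible, because an average determines the code.

*What an average remembers.* The formula enters only through the asymmetric relation `R x y :=
φ(x, y) ∧ ¬ φ(y, x)` on sequences (`strictRel`). All orders are sums `∑_ζ (L ζ)ᵒᵈ` of reversed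
orders (`blockSum`), with a cut below the block of each `δ`; only `δ` of cofinality `κ` are used.
As each sequence of the model sees a skeleton through fewer than `κ` of its elements, both sides
of such a cut look alike to it (`DependsOn.eventually_cut`). Suppose that two cuts are approached
inside a set `B` of sequences, and that their averages over `B` agree. If the upper cofinalities
exceed the support of `B`, then elements close to the cut from above realize the averages, and
therefore the reversed upper halves have matching ends (`endsMatch_of_agree`). Matching ends have
the same cofinality (`EndsMatch.cof_le`), and if they are sums of length a regular `θ > κ`, then
the blocks match again at all `δ` of cofinality `κ` closed under some function
(`incompatible_blockSum`). Hence such ends remember, modulo nonstationary sets, the function that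
assigns to `δ` the end of its block.

*The codes.* By Solovay's splitting (`exists_stationaryAt_partition`) a subset of a regular `μ >
κ` can be coded by blocks of cofinality `κ` or `κ⁺` on disjoint stationary sets. For singular
`lam` one more sum puts codes of subsets of a cofinal family of regular `μ ≤ lam` on disjoint
stationary sets, and a last sum makes the cofinality of the code any regular `θ ∈ (κ, lam]`
(`exists_codes`).

*The counting.* If a small family of `κ`-sets is dense, two skeletons share a set of the family,
and `R` itself singles out its first `κ` elements (`IsCodeFamily.mk_le_of_dense`). The assumptions
`lam ^ κ < 2 ^ lam` and the existence of an order with many cuts reduce to this case. If the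
sequences of the model are an increasing union of `lam` sets of small support, two skeletons share
the cut, the member of the union and a realization of the average
(`IsCodeFamily.mk_le_of_filtration`); this covers `lam = lam ^ ∂` and the case `cf lam > ∂`. In
the remaining two cases the covering assumption puts many cuts into one small set, over which
there are few averages (`IsCodeFamily.mk_lt_of_fewTypes`). The upper bound counts the
structures on a set of size `ν` (`mk_structure_le`).
-/

namespace Skel

/-! ### Stationary sets of points of a given cofinality -/

theorem exists_forall_lt_of_lt_cof {X : Type u} [LinearOrder X] {s : Set X}
    (hs : #s < Order.cof X) : ∃ b, ∀ x ∈ s, x < b :=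
  not_isCofinal_iff.1 fun h => (Order.cof_le h).not_gt hs

theorem exists_forall_lt_range {X ι : Type u} [LinearOrder X] (g : ι → X)
    (h : #ι < Order.cof X) : ∃ b, ∀ i, g i < b := by
  obtain ⟨b, hb⟩ := exists_forall_lt_of_lt_cof (s := Set.range g) (mk_range_le.trans_lt h)
  exact ⟨b, fun i => hb _ ⟨i, rfl⟩⟩

theorem noMaxOrder_of_aleph0_le_cof {X : Type u} [LinearOrder X] (h : ℵ₀ ≤ Order.cof X) :
    NoMaxOrder X :=
  ⟨fun a => by
    obtain ⟨b, hb⟩ := exists_forall_lt_of_lt_cof (s := {a})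
      ((mk_singleton a).trans_lt (one_lt_aleph0.trans_le h))
    exact ⟨b, hb a rfl⟩⟩

theorem nonempty_of_aleph0_le_cof {X : Type u} [LinearOrder X] (h : ℵ₀ ≤ Order.cof X) :
    Nonempty X :=
  Order.cof_ne_zero_iff.1 (aleph0_pos.trans_le h).ne'

theorem cof_ord_toType {θ : Cardinal.{u}} (hθ : θ.IsRegular) : Order.cof θ.ord.ToType = θ := by
  rw [Ordinal.cof_toType, hθ.cof_ord]

theorem mk_Iio_toType_lt {θ : Cardinal.{u}} (δ : θ.ord.ToType) : #(Set.Iio δ) < θ := by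
  simpa using Cardinal.mk_Iio_lt δ (by simp)

theorem mk_Iic_toType_lt {θ : Cardinal.{u}} (hθ : ℵ₀ ≤ θ) (δ : θ.ord.ToType) :
    #(Set.Iic δ) < θ := by
  rw [← Set.Iio_insert]
  exact mk_insert_le.trans_lt (add_lt_of_lt hθ (mk_Iio_toType_lt δ) (one_lt_aleph0.trans_le hθ))

/-- For `θ` regular and `κ < θ`, this says that `{δ ∈ S : cf δ = κ}` is stationary in `θ`: every
club contains all nonzero points closed under some function, so it suffices to meet the sets of
points closed under a function. -/
def StationaryAt (κ : Cardinal.{u}) {W : Type u} [LinearOrder W] (S : Set W) : Prop :=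
  ∀ F : W → W, ∃ δ ∈ S, Order.cof (Set.Iio δ) = κ ∧ ∀ ζ < δ, F ζ < δ

theorem StationaryAt.mono {κ : Cardinal.{u}} {W : Type u} [LinearOrder W] {S T : Set W}
    (h : StationaryAt κ S) (hST : S ⊆ T) : StationaryAt κ T := fun F =>
  let ⟨δ, hδ, h1⟩ := h F
  ⟨δ, hST hδ, h1⟩

variable {κ θ : Cardinal.{u}}

theorem stationaryAt_univ (hκ : κ.IsRegular) (hθ : θ.IsRegular) (hκθ : κ < θ) :
    StationaryAt κ (Set.univ : Set θ.ord.ToType) := by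
  intro F
  have hcof := cof_ord_toType hθ
  have key : ∀ (i : κ.ord.ToType) (g : ∀ j, j < i → θ.ord.ToType), ∃ b : θ.ord.ToType,
      ∀ j (hj : j < i), g j hj < b ∧ ∀ ζ ≤ g j hj, F ζ < b := by
    intro i g
    have hT : #(⋃ j : Set.Iio i, Set.Iic (g j.1 j.2) ∪ F '' Set.Iic (g j.1 j.2)) < θ := by
      refine (card_iUnion_lt_iff_forall_of_isRegular hθ
        ((mk_Iio_toType_lt i).trans hκθ)).2 fun j => ?_
      exact (mk_union_le _ _).trans_lt (add_lt_of_lt hθ.aleph0_le (mk_Iic_toType_lt hθ.aleph0_le _)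
        (mk_image_le.trans_lt (mk_Iic_toType_lt hθ.aleph0_le _)))
    obtain ⟨b, hb⟩ := exists_forall_lt_of_lt_cof (hT.trans_eq hcof.symm)
    refine ⟨b, fun j hj => ⟨hb _ (Set.mem_iUnion.2 ⟨⟨j, hj⟩, .inl (Set.mem_Iic.2 le_rfl)⟩),
      fun ζ hζ => hb _ (Set.mem_iUnion.2 ⟨⟨j, hj⟩, .inr ⟨ζ, hζ, rfl⟩⟩)⟩⟩
  choose B hB using key
  let s : κ.ord.ToType → θ.ord.ToType :=
    WellFounded.fix (wellFounded_lt (α := κ.ord.ToType)) fun i g => B i g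
  have hs : ∀ i, s i = B i fun j _ => s j := fun i => WellFounded.fix_eq _ _ _
  have hs1 : ∀ i j, j < i → s j < s i ∧ ∀ ζ ≤ s j, F ζ < s i := fun i j hj => by
    rw [hs i]; exact hB i (fun j _ => s j) j hj
  have hmono : StrictMono s := fun j i hj => (hs1 i j hj).1
  obtain ⟨b, hb⟩ := exists_forall_lt_range s (X := θ.ord.ToType) (by rwa [mk_ord_toType, hcof])
  let U : Set θ.ord.ToType := {b | ∀ i, s i < b}
  have hδ : (wellFounded_lt.min U ⟨b, hb⟩) ∈ U := WellFounded.min_mem _ _ _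
  have hδ' : ∀ ζ < wellFounded_lt.min U ⟨b, hb⟩, ∃ i, ζ ≤ s i := by
    intro ζ hζ
    by_contra! h
    exact WellFounded.not_lt_min _ U h hζ
  generalize wellFounded_lt.min U ⟨b, hb⟩ = δ at hδ hδ'
  refine ⟨δ, trivial, ?_, fun ζ hζ => ?_⟩
  · rw [← cof_ord_toType hκ]
    refine (Order.cof_congr_of_strictMono (f := fun i => (⟨s i, hδ i⟩ : Set.Iio δ))
      (fun i j h => hmono h) fun ζ => ?_).symm
    obtain ⟨i, hi⟩ := hδ' ζ.1 ζ.2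
    exact ⟨_, ⟨i, rfl⟩, hi⟩
  · obtain ⟨i, hi⟩ := hδ' ζ hζ
    have := noMaxOrder_of_aleph0_le_cof (hκ.aleph0_le.trans_eq (cof_ord_toType hκ).symm)
    obtain ⟨j, hj⟩ := exists_gt i
    exact ((hs1 j i hj).2 ζ hi).trans (hδ j)

/-- Fodor's lemma for the sets `StationaryAt κ`, in the form that a regressive function which is
stationarily often `≥ β` has a stationary fibre over some `γ ≥ β`. -/
theorem exists_stationaryAt_fiber (hθ : θ.IsRegular) {g : θ.ord.ToType → θ.ord.ToType}
    (hg : ∀ δ, Order.cof (Set.Iio δ) = κ → g δ < δ) (β : θ.ord.ToType)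
    (h : StationaryAt κ {δ | β ≤ g δ}) : ∃ γ, β ≤ γ ∧ StationaryAt κ (g ⁻¹' {γ}) := by
  by_contra! hc
  have hc' : ∀ γ, ∃ F : θ.ord.ToType → θ.ord.ToType, β ≤ γ →
      ∀ δ, g δ = γ → Order.cof (Set.Iio δ) = κ → ∃ ζ < δ, δ ≤ F ζ := by
    intro γ
    by_cases hγ : β ≤ γ
    · have := hc γ hγ
      simp only [StationaryAt] at this
      push Not at this
      obtain ⟨F, hF⟩ := this
      exact ⟨F, fun _ δ h1 h2 => hF δ h1 h2⟩
    · exact ⟨id, fun h => (hγ h).elim⟩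
  choose F hF using hc'
  -- A point closed under `G` is closed under `F γ` for all `γ` below it (diagonal intersection).
  have key : ∀ ζ : θ.ord.ToType, ∃ b, ∀ γ ≤ ζ, ∀ ξ ≤ ζ, F γ ξ < b := by
    intro ζ
    obtain ⟨b, hb⟩ := exists_forall_lt_range (X := θ.ord.ToType)
      (fun p : Set.Iic ζ × Set.Iic ζ => F p.1.1 p.2.1) (by
        rw [cof_ord_toType hθ, mk_prod]
        simp only [lift_id]
        exact mul_lt_of_lt hθ.aleph0_le (mk_Iic_toType_lt hθ.aleph0_le _)
          (mk_Iic_toType_lt hθ.aleph0_le _))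
    exact ⟨b, fun γ hγ ξ hξ => hb (⟨γ, hγ⟩, ⟨ξ, hξ⟩)⟩
  choose G hG using key
  obtain ⟨δ, hδ, hcof, hcl⟩ := h G
  obtain ⟨ζ, hζ, hζ'⟩ := hF (g δ) hδ δ rfl hcof
  have h1 := hcl (max (g δ) ζ) (max_lt (hg δ hcof) hζ)
  exact absurd (hζ'.trans_lt (hG _ (g δ) (le_max_left _ _) ζ (le_max_right _ _))) h1.not_gt

/-- Solovay's splitting: the points of cofinality `κ` in a regular cardinal `θ > κ` split into `θ`
disjoint stationary sets. -/
theorem exists_stationaryAt_partition (hκ : κ.IsRegular) (hθ : θ.IsRegular) (hκθ : κ < θ) :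
    ∃ c : θ.ord.ToType → θ.ord.ToType, ∀ i, StationaryAt κ (c ⁻¹' {i}) := by
  have hcof := cof_ord_toType hθ
  -- A cofinal `κ`-sequence below each point of cofinality `κ`.
  have he : ∀ δ : θ.ord.ToType, ∃ e : κ.ord.ToType → θ.ord.ToType,
      Order.cof (Set.Iio δ) = κ → (∀ i, e i < δ) ∧ ∀ ζ < δ, ∃ i, ζ ≤ e i := by
    intro δ
    by_cases hδ : Order.cof (Set.Iio δ) = κ
    · obtain ⟨s, hs, hs'⟩ := Order.exists_cof_eq (Set.Iio δ)
      obtain ⟨e⟩ : Nonempty (κ.ord.ToType ≃ s) :=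
        Cardinal.eq.1 (by rw [mk_ord_toType, hs', hδ])
      refine ⟨fun i => (e i).1.1, fun _ => ⟨fun i => (e i).1.2, fun ζ hζ => ?_⟩⟩
      obtain ⟨x, hx, hζx⟩ := hs ⟨ζ, hζ⟩
      exact ⟨e.symm ⟨x, hx⟩, by simpa using Subtype.coe_le_coe.2 hζx⟩
    · exact ⟨fun _ => δ, fun h => (hδ h).elim⟩
  choose e he using he
  obtain ⟨i, hi⟩ : ∃ i : κ.ord.ToType, ∀ β, StationaryAt κ {δ | β ≤ e δ i} := by
    by_contra! hc
    simp only [StationaryAt] at hc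
    push Not at hc
    choose β F hF using hc
    have key : ∀ ζ : θ.ord.ToType, ∃ b, (∀ i, β i < b) ∧ ∀ i, F i ζ < b := by
      intro ζ
      obtain ⟨b, hb⟩ := exists_forall_lt_range (X := θ.ord.ToType) β
        (by rwa [mk_ord_toType, hcof])
      obtain ⟨b', hb'⟩ := exists_forall_lt_range (X := θ.ord.ToType) (fun i => F i ζ)
        (by rwa [mk_ord_toType, hcof])
      exact ⟨max b b', fun i => lt_max_of_lt_left (hb i), fun i => lt_max_of_lt_right (hb' i)⟩
    choose G hG hG' using key
    obtain ⟨b, hb⟩ := exists_forall_lt_range (X := θ.ord.ToType) β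
        (by rwa [mk_ord_toType, hcof])
    obtain ⟨δ, -, hδ, hcl⟩ := stationaryAt_univ hκ hθ hκθ fun ζ => max b (G ζ)
    have hne := nonempty_of_aleph0_le_cof (hκ.aleph0_le.trans_eq hδ.symm)
    obtain ⟨ζ⟩ := hne
    obtain ⟨i, hi⟩ := (he δ hδ).2 b ((le_max_left _ _).trans_lt (hcl ζ.1 ζ.2))
    obtain ⟨ξ, hξ, hξ'⟩ := hF i δ ((hb i).le.trans hi) hδ
    exact (hξ'.trans_lt (hG' ξ i)).not_gt ((le_max_right _ _).trans_lt (hcl ξ hξ))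
  let Γ : Set θ.ord.ToType := {γ | StationaryAt κ ((fun δ => e δ i) ⁻¹' {γ})}
  have hΓ : #θ.ord.ToType ≤ #Γ := by
    have : IsCofinal Γ := fun β =>
      let ⟨γ, h1, h2⟩ := exists_stationaryAt_fiber hθ (fun δ hδ => (he δ hδ).1 i) β (hi β)
      ⟨γ, h2, h1⟩
    rw [mk_ord_toType]
    exact hcof.symm.trans_le (Order.cof_le this)
  obtain ⟨j⟩ := hΓ
  obtain ⟨p⟩ : Nonempty θ.ord.ToType := nonempty_of_aleph0_le_cof (hθ.aleph0_le.trans_eq hcof.symm)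
  classical
  refine ⟨fun δ => if h : ∃ k, (j k).1 = e δ i then h.choose else p, fun k => ?_⟩
  refine (j k).2.mono fun δ hδ => ?_
  have hk : ∃ k, (j k).1 = e δ i := ⟨k, hδ.symm⟩
  simp only [Set.mem_preimage, Set.mem_singleton_iff, dif_pos hk]
  exact j.injective (Subtype.ext (hk.choose_spec.trans hδ))

/-! ### Sums of reversed linear orders -/

/-- The linear order `∑_{ζ ∈ Z} (L ζ)ᵒᵈ`: blocks indexed by `Z`, each of them the reverse of
`L ζ`. The cut below the block of `δ` has the lower cofinality of `δ` and the upper cofinality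
`cf (L δ)`. -/
def blockSum {Z : Type u} [LinearOrder Z] (L : Z → LinOrd.{u}) : LinOrd.{u} :=
  LinOrd.of (Σₗ ζ, (L ζ)ᵒᵈ)

/-- The element `l` of the block of `ζ`. -/
def pt {Z : Type u} [LinearOrder Z] (L : Z → LinOrd.{u}) (ζ : Z) (l : L ζ) : blockSum L :=
  toLex ⟨ζ, OrderDual.toDual l⟩

section

variable {Z Z' : Type u} [LinearOrder Z] [LinearOrder Z'] {L : Z → LinOrd.{u}}
  {L' : Z' → LinOrd.{u}}

theorem exists_eq_pt (s : blockSum L) : ∃ ζ l, s = pt L ζ l := ⟨_, _, rfl⟩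

theorem pt_injective {ζ : Z} : Function.Injective (pt L ζ) := fun l l' h => by
  have : (⟨ζ, OrderDual.toDual l⟩ : Σ ζ, (L ζ)ᵒᵈ) = ⟨ζ, OrderDual.toDual l'⟩ := h
  simpa using this

theorem pt_lt_pt_iff {ζ : Z} {l l' : L ζ} : pt L ζ l < pt L ζ l' ↔ l' < l := by
  refine (Sigma.Lex.lt_def (a := (⟨ζ, OrderDual.toDual l⟩ : Σₗ ζ, (L ζ)ᵒᵈ))
    (b := (⟨ζ, OrderDual.toDual l'⟩ : Σₗ ζ, (L ζ)ᵒᵈ))).trans ?_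
  simp

theorem pt_lt_pt_of_lt {ζ ζ' : Z} (h : ζ < ζ') (l : L ζ) (l' : L ζ') : pt L ζ l < pt L ζ' l' :=
  (Sigma.Lex.lt_def (a := (⟨ζ, OrderDual.toDual l⟩ : Σₗ ζ, (L ζ)ᵒᵈ))
    (b := (⟨ζ', OrderDual.toDual l'⟩ : Σₗ ζ, (L ζ)ᵒᵈ))).2 (.inl h)

theorem strictMono_pt (f : ∀ ζ, L ζ) : StrictMono fun ζ => pt L ζ (f ζ) :=
  fun _ _ h => pt_lt_pt_of_lt h _ _

theorem mk_blockSum : #(blockSum L) = Cardinal.sum fun ζ => #(L ζ) :=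
  (mk_sigma fun ζ => (L ζ)ᵒᵈ)

theorem mk_le_mk_blockSum (ζ : Z) : #(L ζ) ≤ #(blockSum L) :=
  mk_le_of_injective (pt_injective (ζ := ζ))

theorem mk_blockSum_le {c : Cardinal.{u}} (hc : ℵ₀ ≤ c) (hZ : #Z ≤ c) (hL : ∀ ζ, #(L ζ) ≤ c) :
    #(blockSum L) ≤ c := by
  rw [mk_blockSum]
  refine (Cardinal.sum_le_sum _ (fun _ => c) hL).trans ?_
  rw [sum_const, lift_id, lift_id]
  exact mul_le_of_le hc hZ le_rfl

theorem cof_blockSum [NoMaxOrder Z] (f : ∀ ζ, L ζ) : Order.cof (blockSum L) = Order.cof Z := by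
  refine (Order.cof_congr_of_strictMono (f := fun ζ => pt L ζ (f ζ))
    (strictMono_pt f) fun s => ?_).symm
  obtain ⟨ζ, l, rfl⟩ := exists_eq_pt s
  obtain ⟨ζ', h⟩ := exists_gt ζ
  exact ⟨_, ⟨ζ', rfl⟩, (pt_lt_pt_of_lt h _ _).le⟩

/-! ### Dependence on few elements -/

/-- The truth value of `D s` depends only on the quantifier-free type of `s` over `J`. -/
def DependsOn {I : Type u} [LinearOrder I] (J : Set I) (D : I → Prop) : Prop :=
  ∀ s t, SameQfType J s t → (D s ↔ D t)

theorem DependsOn.mono {I : Type u} [LinearOrder I] {J J' : Set I} {D : I → Prop}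
    (h : DependsOn J D) (hJ : J ⊆ J') : DependsOn J' D :=
  fun s t hst => h s t fun j hj => hst j (hJ hj)

theorem DependsOn.and_not {I : Type u} [LinearOrder I] {J : Set I} {D D' : I → Prop}
    (h : DependsOn J D) (h' : DependsOn J D') : DependsOn J fun s => D s ∧ ¬ D' s :=
  fun s t hst => and_congr (h s t hst) (not_congr (h' s t hst))

theorem exists_common_support {κ : Cardinal.{u}} (hκ : ℵ₀ ≤ κ) {C I : Type u}
    {p : C → Set I → Prop} (hmono : ∀ c J J', J ⊆ J' → p c J → p c J')
    (h : ∀ c, ∃ J : Set I, #J < κ ∧ p c J) (B : Set C) :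
    ∃ J : Set I, #J ≤ max #B κ ∧ ∀ c ∈ B, p c J := by
  choose J hJ hD using h
  refine ⟨⋃ c : B, J c, ?_, fun c hc =>
    hmono c _ _ (Set.subset_iUnion (fun c : B => J c) ⟨c, hc⟩) (hD c)⟩
  refine (mk_iUnion_le_sum_mk).trans
    ((Cardinal.sum_le_sum (fun c : B => #(J c)) (fun _ => κ) fun c => (hJ c).le).trans ?_)
  rw [sum_const, lift_id, lift_id]
  exact mul_le_max_of_aleph0_le_right hκ

theorem DependsOn.block {J : Set (blockSum L)} {D : blockSum L → Prop} (h : DependsOn J D)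
    (δ : Z) : DependsOn (pt L δ ⁻¹' J) fun l => D (pt L δ l) := by
  intro l l' hl
  refine h _ _ fun j hj => ?_
  obtain ⟨ζ, m, rfl⟩ := exists_eq_pt j
  rcases lt_trichotomy ζ δ with hζ | rfl | hζ
  · have h1 := pt_lt_pt_of_lt hζ m l
    have h2 := pt_lt_pt_of_lt hζ m l'
    simp [h1, h2, h1.not_gt, h2.not_gt, h1.ne', h2.ne']
  · have := hl m hj
    simp only [pt_lt_pt_iff, pt_injective.eq_iff]
    tauto
  · have h1 := pt_lt_pt_of_lt hζ l m
    have h2 := pt_lt_pt_of_lt hζ l' m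
    simp [h1, h2, h1.not_gt, h2.not_gt, h1.ne, h2.ne]

/-- Above a bound of the part of `J` in the block of `δ`, towards the cut, nothing that depends on
`J` changes. -/
theorem exists_forall_block_iff {J : Set (blockSum L)} {δ : Z} (hJ : #J < Order.cof (L δ)) :
    ∃ l₀ : L δ, ∀ l, l₀ ≤ l → ∀ D : blockSum L → Prop, DependsOn J D →
      (D (pt L δ l) ↔ D (pt L δ l₀)) := by
  obtain ⟨l₀, hl₀⟩ := exists_forall_lt_of_lt_cof (X := L δ) (s := pt L δ ⁻¹' J)
    ((mk_preimage_of_injective _ _ pt_injective).trans_lt hJ)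
  refine ⟨l₀, fun l hl D hD => hD.block δ _ _ fun j hj => ?_⟩
  have h1 := hl₀ j hj
  have h2 := h1.trans_le hl
  simp [h1, h2, h1.not_gt, h2.not_gt, h1.ne', h2.ne']

open Filter in
/-- If both cofinalities of the cut below the block of `δ` are at least `κ`, then a property that
depends on fewer than `κ` elements has the same constant truth value on both sides of the cut. -/
theorem DependsOn.eventually_cut {κ : Cardinal.{u}} {J : Set (blockSum L)}
    {D : blockSum L → Prop} (h : DependsOn J D) (hJ : #J < κ) {δ : Z}
    (hδ : κ ≤ Order.cof (Set.Iio δ)) (hL : κ ≤ Order.cof (L δ)) (f : ∀ ζ, L ζ) :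
    ((∀ᶠ ζ : Set.Iio δ in atTop, D (pt L ζ (f ζ))) ∧ ∀ᶠ l in atTop, D (pt L δ l)) ∨
    ((∀ᶠ ζ : Set.Iio δ in atTop, ¬ D (pt L ζ (f ζ))) ∧ ∀ᶠ l in atTop, ¬ D (pt L δ l)) := by
  obtain ⟨l₀, hl₀⟩ := exists_forall_lt_of_lt_cof (X := L δ) (s := pt L δ ⁻¹' J)
    ((mk_preimage_of_injective _ _ pt_injective).trans_lt (hJ.trans_le hL))
  obtain ⟨ζ₀, hζ₀⟩ := exists_forall_lt_of_lt_cof (X := Set.Iio δ)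
    (s := {ζ | ∃ l, pt L ζ.1 l ∈ J}) (by
      refine lt_of_le_of_lt ?_ (hJ.trans_le hδ)
      have : ∀ ζ : {ζ : Set.Iio δ | ∃ l, pt L ζ.1 l ∈ J}, ∃ l, pt L ζ.1.1 l ∈ J := fun ζ => ζ.2
      choose g hg using this
      refine mk_le_of_injective (f := fun ζ => (⟨_, hg ζ⟩ : J)) fun ζ ζ' hζ => ?_
      have : ζ.1.1 = ζ'.1.1 := congrArg (fun s : J => (ofLex (α := Σ ζ, (L ζ)ᵒᵈ) s.1).1) hζ
      exact Subtype.ext (Subtype.ext this))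
  have key : ∀ ζ : Set.Iio δ, ζ₀ ≤ ζ → ∀ l, l₀ ≤ l → (D (pt L ζ (f ζ)) ↔ D (pt L δ l)) := by
    intro ζ hζ l hl
    refine h _ _ fun j hj => ?_
    obtain ⟨ξ, m, rfl⟩ := exists_eq_pt j
    rcases lt_trichotomy ξ δ with hξ | rfl | hξ
    · have h0 : ξ < ζ.1 := (hζ₀ ⟨ξ, hξ⟩ ⟨m, hj⟩).trans_le hζ
      have h1 := pt_lt_pt_of_lt h0 m (f ζ)
      have h2 := pt_lt_pt_of_lt hξ m l
      simp [h1, h2, h1.not_gt, h2.not_gt, h1.ne', h2.ne']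
    · have h1 := pt_lt_pt_of_lt (L := L) ζ.2 (f ζ) m
      have h2 := pt_lt_pt_iff.2 ((hl₀ m hj).trans_le hl)
      simp [h1, h2, h1.not_gt, h2.not_gt, h1.ne, h2.ne]
    · have h1 := pt_lt_pt_of_lt (L := L) (lt_trans ζ.2 hξ) (f ζ) m
      have h2 := pt_lt_pt_of_lt hξ l m
      simp [h1, h2, h1.not_gt, h2.not_gt, h1.ne, h2.ne]
  by_cases hD : D (pt L δ l₀)
  · have := fun ζ hζ => (key ζ hζ l₀ le_rfl).2 hD
    exact .inl ⟨(eventually_ge_atTop ζ₀).mono this, (eventually_ge_atTop l₀).mono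
      fun l hl => (key ζ₀ le_rfl l hl).1 (this ζ₀ le_rfl)⟩
  · have := fun ζ hζ => (key ζ hζ l₀ le_rfl).not.2 hD
    exact .inr ⟨(eventually_ge_atTop ζ₀).mono this, (eventually_ge_atTop l₀).mono
      fun l hl => (key ζ₀ le_rfl l hl).not.1 (this ζ₀ le_rfl)⟩

open Filter in
theorem DependsOn.eventually_cut_iff {κ : Cardinal.{u}} (hκ : ℵ₀ ≤ κ) {J : Set (blockSum L)}
    {D : blockSum L → Prop} (h : DependsOn J D) (hJ : #J < κ) {δ : Z}
    (hδ : κ ≤ Order.cof (Set.Iio δ)) (hL : κ ≤ Order.cof (L δ)) (f : ∀ ζ, L ζ) :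
    (∀ᶠ ζ : Set.Iio δ in atTop, D (pt L ζ (f ζ))) ↔ ∀ᶠ l in atTop, D (pt L δ l) := by
  have := nonempty_of_aleph0_le_cof (hκ.trans hδ)
  have := nonempty_of_aleph0_le_cof (hκ.trans hL)
  rcases h.eventually_cut hJ hδ hL f with ⟨h1, h2⟩ | ⟨h1, h2⟩
  · exact iff_of_true h1 h2
  · exact iff_of_false (fun h => (h1.and h).exists.elim fun _ h => h.1 h.2)
      fun h => (h2.and h).exists.elim fun _ h => h.1 h.2

open Filter in
theorem DependsOn.eventually_of_frequently {κ : Cardinal.{u}} {J : Set (blockSum L)}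
    {D : blockSum L → Prop} (h : DependsOn J D) (hJ : #J < κ) {δ : Z}
    (hδ : κ ≤ Order.cof (Set.Iio δ)) (hL : κ ≤ Order.cof (L δ)) (f : ∀ ζ, L ζ)
    (hD : ∃ᶠ ζ : Set.Iio δ in atTop, D (pt L ζ (f ζ))) : ∀ᶠ l in atTop, D (pt L δ l) := by
  rcases h.eventually_cut hJ hδ hL f with ⟨h1, h2⟩ | ⟨h1, h2⟩
  · exact h2
  · exact (hD h1).elim

/-! ### Skeletons and matching ends -/

section

variable {V : Type u}

/-- `⟨a_s : s ∈ I⟩` is increasing for the relation `R`, and the truth values of `R c (a s)` and of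
`R (a s) c` depend on the position of `s` relative to fewer than `κ` elements of `I`. -/
structure IsSkeleton (κ : Cardinal.{u}) (R : V → V → Prop) {I : Type u} [LinearOrder I]
    (a : I → V) : Prop where
  rel_iff : ∀ s t, R (a s) (a t) ↔ s < t
  left : ∀ c, ∃ J : Set I, #J < κ ∧ DependsOn J fun s => R c (a s)
  right : ∀ c, ∃ J : Set I, #J < κ ∧ DependsOn J fun s => R (a s) c

/-- The restriction of a skeleton to a block is a skeleton for the reversed relation. -/
theorem IsSkeleton.block {κ : Cardinal.{u}} {R : V → V → Prop} {a : blockSum L → V}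
    (h : IsSkeleton κ R a) (δ : Z) :
    IsSkeleton κ (fun x y => R y x) fun l => a (pt L δ l) where
  rel_iff s t := by rw [h.rel_iff, pt_lt_pt_iff]
  left c :=
    let ⟨_, hJ, hD⟩ := h.right c
    ⟨_, (mk_preimage_of_injective _ _ pt_injective).trans_lt hJ, hD.block δ⟩
  right c :=
    let ⟨_, hJ, hD⟩ := h.left c
    ⟨_, (mk_preimage_of_injective _ _ pt_injective).trans_lt hJ, hD.block δ⟩

theorem IsSkeleton.injective {κ : Cardinal.{u}} {R : V → V → Prop} {I : Type u} [LinearOrder I]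
    {a : I → V} (h : IsSkeleton κ R a) : Function.Injective a := fun s t hst => by
  rcases lt_trichotomy s t with h1 | h1 | h1
  · have := (h.rel_iff s t).2 h1
    rw [hst, h.rel_iff] at this
    exact (lt_irrefl _ this).elim
  · exact h1
  · have := (h.rel_iff t s).2 h1
    rw [hst, h.rel_iff] at this
    exact (lt_irrefl _ this).elim

open Filter in
/-- The sequences `a` and `b` have the same end with respect to `R`: every late `b t` lies below all
sufficiently late `a s`, and vice versa. As `R` is not assumed to be transitive, how late depends
on `t`. -/
def EndsMatch (R : V → V → Prop) {I I' : Type u} [LinearOrder I] [LinearOrder I'] (a : I → V)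
    (b : I' → V) : Prop :=
  (∀ᶠ t in atTop, ∀ᶠ s in atTop, R (b t) (a s)) ∧ ∀ᶠ s in atTop, ∀ᶠ t in atTop, R (a s) (b t)

theorem EndsMatch.symm {R : V → V → Prop} {I I' : Type u} [LinearOrder I] [LinearOrder I']
    {a : I → V} {b : I' → V} (h : EndsMatch R a b) : EndsMatch R b a := ⟨h.2, h.1⟩

end

/-- The ends of skeletons indexed by `P` and by `Q` never match. -/
def Incompatible (κ : Cardinal.{u}) (P Q : LinOrd.{u}) : Prop :=
  ∀ (V : Type u) (R : V → V → Prop) (a : P → V) (b : Q → V), (∀ x y, R x y → ¬ R y x) →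
    IsSkeleton κ R a → IsSkeleton κ R b → ¬ EndsMatch R a b

theorem Incompatible.symm {κ : Cardinal.{u}} {P Q : LinOrd.{u}} (h : Incompatible κ P Q) :
    Incompatible κ Q P := fun V R a b hR ha hb he => h V R b a hR hb ha he.symm

/-- By symmetry, matching ends have equal cofinalities. Otherwise a member of `b` would lie above a
cofinal part of `a` and also below the end of `a`. -/
theorem EndsMatch.cof_le {V : Type u} {R : V → V → Prop} (hR : ∀ x y, R x y → ¬ R y x)
    {I I' : Type u} [LinearOrder I] [LinearOrder I'] {a : I → V} {b : I' → V}
    (hI : ℵ₀ ≤ Order.cof I) (hI' : ℵ₀ ≤ Order.cof I') (h : EndsMatch R a b) :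
    Order.cof I' ≤ Order.cof I := by
  have := nonempty_of_aleph0_le_cof hI
  have := nonempty_of_aleph0_le_cof hI'
  by_contra! hlt
  obtain ⟨s₀, hs₀⟩ := Filter.eventually_atTop.1 h.2
  obtain ⟨t₀, ht₀⟩ := Filter.eventually_atTop.1 h.1
  obtain ⟨S, hS, hS'⟩ := Order.exists_cof_eq I
  have : ∀ s : S, ∃ t, ∀ t', t ≤ t' → R (a (max s.1 s₀)) (b t') := fun s =>
    Filter.eventually_atTop.1 (hs₀ _ (le_max_right _ _))
  choose g hg using this
  obtain ⟨t, ht⟩ := exists_forall_lt_range g (hS'.trans_lt hlt)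
  obtain ⟨s, hs⟩ := Filter.eventually_atTop.1 (ht₀ (max t t₀) (le_max_right _ _))
  obtain ⟨s', hs', hss'⟩ := hS s
  exact hR _ _ (hs (max s' s₀) (hss'.trans (le_max_left _ _)))
    (hg ⟨s', hs'⟩ _ ((ht _).le.trans (le_max_left _ _)))

theorem incompatible_of_cof_ne {κ : Cardinal.{u}} {P Q : LinOrd.{u}} (hP : ℵ₀ ≤ Order.cof P)
    (hQ : ℵ₀ ≤ Order.cof Q) (h : Order.cof P ≠ Order.cof Q) : Incompatible κ P Q :=
  fun _ _ _ _ hR _ _ he => h ((he.symm.cof_le hR hQ hP).antisymm (he.cof_le hR hP hQ))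

section

variable {V : Type u} {R : V → V → Prop} {κ : Cardinal.{u}} {a : blockSum L → V}
  {b : blockSum L' → V}

open Filter in
/-- If the lower halves of two cuts are interleaved as seen from the upper halves, then the upper
halves match. -/
theorem endsMatch_block (ha : IsSkeleton κ R a) (hb : IsSkeleton κ R b)
    {δ : Z} {δ' : Z'} (hδ : κ ≤ Order.cof (Set.Iio δ)) (hL : κ ≤ Order.cof (L δ))
    (hδ' : κ ≤ Order.cof (Set.Iio δ')) (hL' : κ ≤ Order.cof (L' δ'))
    (f : ∀ ζ, L ζ) (f' : ∀ ζ, L' ζ)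
    (h : ∀ᶠ l' in atTop, ∃ᶠ ζ : Set.Iio δ in atTop, R (a (pt L ζ (f ζ))) (b (pt L' δ' l')))
    (h' : ∀ᶠ l in atTop, ∃ᶠ ζ : Set.Iio δ' in atTop, R (b (pt L' ζ (f' ζ))) (a (pt L δ l))) :
    EndsMatch (fun x y => R y x) (fun l => a (pt L δ l)) fun l => b (pt L' δ' l) := by
  refine ⟨h.mono fun l' hl' => ?_, h'.mono fun l hl => ?_⟩
  · obtain ⟨J, hJ, hD⟩ := ha.right (b (pt L' δ' l'))
    exact hD.eventually_of_frequently hJ hδ hL f hl'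
  · obtain ⟨J, hJ, hD⟩ := hb.right (a (pt L δ l))
    exact hD.eventually_of_frequently hJ hδ' hL' f' hl

open Filter in
/-- One direction of `endsMatch_of_agree`: the average of the lower half of the cut at `δ'` contains
`R c ·` for the members `c ∈ B` of the lower half of the cut at `δ`, and it is realized over `B` by
all elements of the upper half that are close to the cut. -/
theorem frequently_of_agree (hκ : ℵ₀ ≤ κ) (ha : IsSkeleton κ R a) (hb : IsSkeleton κ R b)
    {δ : Z} {δ' : Z'} (hδ : κ ≤ Order.cof (Set.Iio δ))
    (hδ' : κ ≤ Order.cof (Set.Iio δ')) (hL' : κ ≤ Order.cof (L' δ'))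
    (f : ∀ ζ, L ζ) (f' : ∀ ζ, L' ζ) (B : Set V)
    (hB : ∃ᶠ ζ : Set.Iio δ in atTop, a (pt L ζ (f ζ)) ∈ B)
    (hJ : ∃ J : Set (blockSum L'), #J < Order.cof (L' δ') ∧
      ∀ c ∈ B, DependsOn J fun s => R c (b s))
    (hq : ∀ c ∈ B, (∀ᶠ ζ : Set.Iio δ in atTop, R c (a (pt L ζ (f ζ)))) →
      ∀ᶠ ζ : Set.Iio δ' in atTop, R c (b (pt L' ζ (f' ζ)))) :
    ∀ᶠ l' in atTop, ∃ᶠ ζ : Set.Iio δ in atTop, R (a (pt L ζ (f ζ))) (b (pt L' δ' l')) := by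
  have := nonempty_of_aleph0_le_cof (hκ.trans hL')
  have := noMaxOrder_of_aleph0_le_cof (hκ.trans hδ)
  obtain ⟨J, hJ, hD⟩ := hJ
  obtain ⟨l₀, hl₀⟩ := exists_forall_block_iff hJ
  refine (eventually_ge_atTop l₀).mono fun l hl => hB.mono fun ζ hζ => ?_
  have h1 : ∀ᶠ ξ : Set.Iio δ in atTop, R (a (pt L ζ (f ζ))) (a (pt L ξ (f ξ))) :=
    (eventually_gt_atTop ζ).mono fun ξ hξ =>
      (ha.rel_iff _ _).2 (pt_lt_pt_of_lt (Subtype.coe_lt_coe.2 hξ) _ _)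
  obtain ⟨J', hJ', hD'⟩ := hb.left (a (pt L ζ (f ζ)))
  have h2 := (hD'.eventually_cut_iff hκ hJ' hδ' hL' f').1 (hq _ hζ h1)
  obtain ⟨m, hm, hm'⟩ := ((eventually_ge_atTop l₀).and h2).exists
  exact (hl₀ l hl _ (hD _ hζ)).2 ((hl₀ m hm _ (hD _ hζ)).1 hm')

open Filter in
/-- Two cuts whose lower halves meet `B` cofinally and have the same average over `B` have matching
upper halves, provided that the upper cofinalities exceed the number of elements on which the
relations to members of `B` depend: then elements of the upper halves realize the averages, and so
they see that the lower halves are interleaved. -/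
theorem endsMatch_of_agree (hκ : ℵ₀ ≤ κ) (ha : IsSkeleton κ R a) (hb : IsSkeleton κ R b)
    {δ : Z} {δ' : Z'} (hδ : κ ≤ Order.cof (Set.Iio δ)) (hL : κ ≤ Order.cof (L δ))
    (hδ' : κ ≤ Order.cof (Set.Iio δ')) (hL' : κ ≤ Order.cof (L' δ'))
    (f : ∀ ζ, L ζ) (f' : ∀ ζ, L' ζ) (B : Set V)
    (hB : ∃ᶠ ζ : Set.Iio δ in atTop, a (pt L ζ (f ζ)) ∈ B)
    (hB' : ∃ᶠ ζ : Set.Iio δ' in atTop, b (pt L' ζ (f' ζ)) ∈ B)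
    (hJ : ∃ J : Set (blockSum L), #J < Order.cof (L δ) ∧
      ∀ c ∈ B, DependsOn J fun s => R c (a s))
    (hJ' : ∃ J : Set (blockSum L'), #J < Order.cof (L' δ') ∧
      ∀ c ∈ B, DependsOn J fun s => R c (b s))
    (hq : ∀ c ∈ B, (∀ᶠ ζ : Set.Iio δ in atTop, R c (a (pt L ζ (f ζ)))) ↔
      ∀ᶠ ζ : Set.Iio δ' in atTop, R c (b (pt L' ζ (f' ζ)))) :
    EndsMatch (fun x y => R y x) (fun l => a (pt L δ l)) fun l => b (pt L' δ' l) :=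
  endsMatch_block ha hb hδ hL hδ' hL' f f'
    (frequently_of_agree hκ ha hb hδ hδ' hL' f f' B hB hJ' fun c hc => (hq c hc).1)
    (frequently_of_agree hκ hb ha hδ' hδ hL f' f B hB' hJ fun c hc => (hq c hc).2)

end

end

open Filter in
/-- Sums of reversed orders along a regular cardinal are incompatible if their blocks are
incompatible stationarily often: matching ends are interleaved, hence they are interleaved below
any `δ` closed under a suitable function, and so the upper halves of the cuts at `δ` match. -/
theorem incompatible_blockSum {κ θ : Cardinal.{u}} (hκ : κ.IsRegular) (hθ : θ.IsRegular)
    {L L' : θ.ord.ToType → LinOrd.{u}}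
    (hL : ∀ ζ, κ ≤ Order.cof (L ζ)) (hL' : ∀ ζ, κ ≤ Order.cof (L' ζ))
    (h : StationaryAt κ {δ | Incompatible κ (L δ) (L' δ)}) :
    Incompatible κ (blockSum L) (blockSum L') := by
  intro V R a b hR ha hb he
  have hne : ∀ ζ, Nonempty (L ζ) := fun ζ => nonempty_of_aleph0_le_cof (hκ.aleph0_le.trans (hL ζ))
  have hne' : ∀ ζ, Nonempty (L' ζ) :=
    fun ζ => nonempty_of_aleph0_le_cof (hκ.aleph0_le.trans (hL' ζ))
  let f : ∀ ζ, L ζ := fun ζ => (hne ζ).some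
  let f' : ∀ ζ, L' ζ := fun ζ => (hne' ζ).some
  have hcof := cof_ord_toType hθ
  have hZ := nonempty_of_aleph0_le_cof (hθ.aleph0_le.trans_eq hcof.symm)
  have := noMaxOrder_of_aleph0_le_cof (hθ.aleph0_le.trans_eq hcof.symm)
  have aux : ∀ {L L' : θ.ord.ToType → LinOrd.{u}} (f : ∀ ζ, L ζ) (_ : ∀ ζ, L' ζ)
      (a : blockSum L → V) (b : blockSum L' → V),
      (∀ᶠ s in atTop, ∀ᶠ t in atTop, R (a s) (b t)) →
      ∃ (ζ₀ : θ.ord.ToType) (F : θ.ord.ToType → θ.ord.ToType),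
        ∀ ζ, ζ₀ ≤ ζ → ∀ ξ, F ζ ≤ ξ → ∀ l, R (a (pt L ζ (f ζ))) (b (pt L' ξ l)) := by
    intro L L' f f' a b hab
    have : Nonempty (blockSum L) := hZ.map fun ζ => pt L ζ (f ζ)
    have : Nonempty (blockSum L') := hZ.map fun ζ => pt L' ζ (f' ζ)
    obtain ⟨s₀, hs₀⟩ := eventually_atTop.1 hab
    obtain ⟨ζ₁, l₁, rfl⟩ := exists_eq_pt s₀
    obtain ⟨ζ₀, hζ₀⟩ := exists_gt ζ₁
    have : ∀ ζ, ∃ ξ₀, ζ₀ ≤ ζ → ∀ ξ, ξ₀ ≤ ξ → ∀ l, R (a (pt L ζ (f ζ))) (b (pt L' ξ l)) := by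
      intro ζ
      by_cases hζ : ζ₀ ≤ ζ
      · obtain ⟨t, ht⟩ := eventually_atTop.1
          (hs₀ _ (pt_lt_pt_of_lt (hζ₀.trans_le hζ) l₁ (f ζ)).le)
        obtain ⟨ξ, m, rfl⟩ := exists_eq_pt t
        obtain ⟨ξ₀, hξ₀⟩ := exists_gt ξ
        exact ⟨ξ₀, fun _ ξ' hξ' l => ht _ (pt_lt_pt_of_lt (hξ₀.trans_le hξ') m l).le⟩
      · exact ⟨ζ, fun h => (hζ h).elim⟩
    choose F hF using this
    exact ⟨ζ₀, F, fun ζ h1 ξ h2 l => hF ζ h1 ξ h2 l⟩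
  obtain ⟨ζ₁, F₁, hF₁⟩ := aux f f' a b he.2
  obtain ⟨ζ₂, F₂, hF₂⟩ := aux f' f b a he.1
  obtain ⟨δ, hδ, hcofδ, hcl⟩ := h fun ζ => max (max ζ₁ ζ₂) (max (F₁ ζ) (F₂ ζ))
  have hne := nonempty_of_aleph0_le_cof (hκ.aleph0_le.trans_eq hcofδ.symm)
  have hlt := hne.elim fun ζ => (le_max_left _ _).trans_lt (hcl ζ.1 ζ.2)
  have hlt' := fun ζ hζ => (le_max_right _ _).trans_lt (hcl ζ hζ)
  refine hδ V _ _ _ (fun x y h => hR y x h) (ha.block δ) (hb.block δ)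
    (endsMatch_block ha hb hcofδ.ge (hL δ) hcofδ.ge (hL' δ) f f'
      (.of_forall fun l => Eventually.frequently ?_) (.of_forall fun l => Eventually.frequently ?_))
  · refine (eventually_ge_atTop (⟨ζ₁, (le_max_left _ _).trans_lt hlt⟩ : Set.Iio δ)).mono
      fun ζ hζ => hF₁ ζ hζ δ ((le_max_left _ _).trans (hlt' ζ.1 ζ.2).le) l
  · refine (eventually_ge_atTop (⟨ζ₂, (le_max_right _ _).trans_lt hlt⟩ : Set.Iio δ)).mono
      fun ζ hζ => hF₂ ζ hζ δ ((le_max_right _ _).trans (hlt' ζ.1 ζ.2).le) l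

/-! ### Coding subsets of a cardinal by incompatible linear orders -/

theorem exists_mk_Iio_eq {lam c : Cardinal.{u}} (h : c < lam) :
    ∃ x : lam.ord.ToType, #(Set.Iio x) = c := by
  obtain ⟨x, hx⟩ := Ordinal.typein_surj (α := lam.ord.ToType) (· < ·) (o := c.ord)
    (by simpa using ord_lt_ord.2 h)
  refine ⟨x, ?_⟩
  have := congrArg Ordinal.card hx
  rwa [card_ord] at this

/-- Every cardinal `lam > κ` is approached by at most `ρ` many regular cardinals, for a regular
`ρ ≤ lam`; if `lam` is singular, then `ρ` can be chosen larger than `cf lam`. -/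
theorem exists_regular_cover {κ lam : Cardinal.{u}} (hκ : κ.IsRegular) (h : κ < lam) :
    ∃ (ρ : Cardinal.{u}) (m : ρ.ord.ToType → Cardinal.{u}), ρ.IsRegular ∧ κ < ρ ∧ ρ ≤ lam ∧
      (∀ i, (m i).IsRegular ∧ κ < m i ∧ m i ≤ lam) ∧ (∀ c < lam, ∃ i, c < m i) ∧
      ((ρ = lam ∧ ∀ i, m i = lam) ∨ lam.ord.cof < ρ) := by
  have hlam := hκ.aleph0_le.trans h.le
  by_cases hr : lam.IsRegular
  · have := nonempty_of_aleph0_le_cof (hlam.trans_eq (cof_ord_toType hr).symm)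
    exact ⟨lam, fun _ => lam, hr, h, le_rfl, fun _ => ⟨hr, h, le_rfl⟩,
      fun c hc => ⟨Classical.arbitrary _, hc⟩, .inl ⟨rfl, fun _ => rfl⟩⟩
  · have hcof : lam.ord.cof < lam := by
      by_contra! hc
      exact hr ⟨hlam, hc⟩
    have hsucc : ∀ c, κ ≤ c → c < lam → (Order.succ c).IsRegular ∧ Order.succ c ≤ lam :=
      fun c hc hc' => ⟨isRegular_succ (hκ.aleph0_le.trans hc), Order.succ_le_of_lt hc'⟩
    obtain ⟨s, hs, hs'⟩ := Order.exists_cof_eq lam.ord.ToType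
    rw [Ordinal.cof_toType] at hs'
    have hlt := max_lt hcof h
    have h1 := hsucc _ (le_max_right _ _) hlt
    have hle : #s ≤ #(Order.succ (max lam.ord.cof κ)).ord.ToType := by
      rw [mk_ord_toType, hs']
      exact (le_max_left _ _).trans (Order.le_succ _)
    obtain ⟨x₀, -⟩ := exists_mk_Iio_eq h
    obtain ⟨y₀, hy₀, -⟩ := hs x₀
    have : Nonempty s := ⟨⟨y₀, hy₀⟩⟩
    obtain ⟨e⟩ := hle
    have hsurj := Function.invFun_surjective e.injective
    refine ⟨_, fun i => Order.succ (max κ #(Set.Iio (Function.invFun e i).1)), h1.1,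
      Order.lt_succ_of_le (le_max_right _ _), h1.2, fun i => ?_, fun c hc => ?_,
      .inr (Order.lt_succ_of_le (le_max_left _ _))⟩
    · have := hsucc _ (le_max_left _ _) (max_lt h (mk_Iio_toType_lt (Function.invFun e i).1))
      exact ⟨this.1, Order.lt_succ_of_le (le_max_left _ _), this.2⟩
    · obtain ⟨x, rfl⟩ := exists_mk_Iio_eq hc
      obtain ⟨y, hy, hxy⟩ := hs x
      obtain ⟨i, hi⟩ := hsurj ⟨y, hy⟩
      refine ⟨i, Order.lt_succ_of_le (le_max_of_le_right ?_)⟩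
      rw [hi]
      exact mk_le_mk_of_subset (Set.Iio_subset_Iio hxy)

theorem cof_blockSum_regular {θ : Cardinal.{u}} (hθ : θ.IsRegular)
    {L : θ.ord.ToType → LinOrd.{u}} (hL : ∀ ζ, ℵ₀ ≤ Order.cof (L ζ)) :
    Order.cof (blockSum L) = θ := by
  have hcof := cof_ord_toType hθ
  have := noMaxOrder_of_aleph0_le_cof (hθ.aleph0_le.trans_eq hcof.symm)
  rw [cof_blockSum fun ζ => (nonempty_of_aleph0_le_cof (hL ζ)).some, hcof]

/-- Subsets of a regular cardinal `μ > κ` are coded by orders of size and cofinality `μ`: the upper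
cofinalities of the cuts are `κ` on the stationary sets that belong to elements of the subset, and
`κ⁺` elsewhere. -/
theorem exists_codes_regular {κ μ : Cardinal.{u}} (hκ : κ.IsRegular) (hμ : μ.IsRegular)
    (h : κ < μ) : ∃ P : Set μ.ord.ToType → LinOrd.{u},
      (∀ X, Order.cof (P X) = μ ∧ #(P X) = μ) ∧ ∀ X Y, X ≠ Y → Incompatible κ (P X) (P Y) := by
  classical
  obtain ⟨c, hc⟩ := exists_stationaryAt_partition hκ hμ h
  have hκ' := isRegular_succ hκ.aleph0_le
  let A : Prop → Cardinal.{u} := fun p => if p then κ else Order.succ κ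
  have hA : ∀ p, (A p).IsRegular ∧ κ ≤ A p ∧ A p ≤ μ := by
    intro p
    by_cases hp : p
    · simp only [A, if_pos hp]
      exact ⟨hκ, le_rfl, h.le⟩
    · simp only [A, if_neg hp]
      exact ⟨hκ', Order.le_succ _, Order.succ_le_of_lt h⟩
  let L : Set μ.ord.ToType → μ.ord.ToType → LinOrd.{u} :=
    fun X ζ => LinOrd.of (A (c ζ ∈ X)).ord.ToType
  have hL : ∀ X ζ, Order.cof (L X ζ) = A (c ζ ∈ X) := fun X ζ => cof_ord_toType (hA _).1
  have hL' : ∀ X ζ, κ ≤ Order.cof (L X ζ) := fun X ζ => (hA _).2.1.trans_eq (hL X ζ).symm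
  have hcof := fun X => cof_blockSum_regular hμ fun ζ => hκ.aleph0_le.trans (hL' X ζ)
  have hstep : ∀ X Y i, i ∈ X → i ∉ Y →
      Incompatible κ (blockSum (L X)) (blockSum (L Y)) := by
    intro X Y i hX hY
    refine incompatible_blockSum hκ hμ (hL' X) (hL' Y) ((hc i).mono fun δ hδ => ?_)
    refine incompatible_of_cof_ne (hκ.aleph0_le.trans (hL' X δ)) (hκ.aleph0_le.trans (hL' Y δ)) ?_
    have : c δ = i := hδ
    rw [hL, hL, this]
    simp only [A, if_pos hX, if_neg hY]
    exact (Order.lt_succ κ).ne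
  refine ⟨fun X => blockSum (L X), fun X => ⟨hcof X, le_antisymm ?_ ?_⟩, fun X Y hXY => ?_⟩
  · refine mk_blockSum_le hμ.aleph0_le (mk_ord_toType _).le fun ζ => ?_
    exact (mk_ord_toType _).trans_le (hA _).2.2
  · exact (hcof X).symm.trans_le (Order.cof_le_cardinalMk _)
  · by_contra! hn
    refine hXY (Set.ext fun i => ⟨fun hi => ?_, fun hi => ?_⟩)
    · by_contra hi'
      exact hn (hstep X Y i hi hi')
    · by_contra hi'
      exact hn (hstep Y X i hi hi').symm

/-- For every `lam > κ` there are `2 ^ lam` codes `w`, each realized by linear orders `L w θ` of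
size `lam` and of any prescribed regular cofinality `θ ∈ (κ, lam]`, such that orders with different
codes are incompatible. A code is a family of subsets of the regular cardinals in a cover of `lam`;
the orders coding these subsets are placed into the cuts on disjoint stationary sets. -/
theorem exists_codes {κ lam : Cardinal.{u}} (hκ : κ.IsRegular) (h : κ < lam) :
    ∃ (W : Type u) (L : W → Cardinal.{u} → LinOrd.{u}), #W = 2 ^ lam ∧
      (∀ w θ, θ.IsRegular → κ < θ → θ ≤ lam → Order.cof (L w θ) = θ ∧ #(L w θ) = lam) ∧
      ∀ w w' θ θ', w ≠ w' → θ.IsRegular → κ < θ → θ'.IsRegular → κ < θ' →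
        Incompatible κ (L w θ) (L w' θ') := by
  have hlam := hκ.aleph0_le.trans h.le
  obtain ⟨ρ, m, hρ, hκρ, hρlam, hm, hcov, -⟩ := exists_regular_cover hκ h
  obtain ⟨c, hc⟩ := exists_stationaryAt_partition hκ hρ hκρ
  have hP := fun i => exists_codes_regular hκ (hm i).1 (hm i).2.1
  choose P hP1 hP2 using hP
  let W : Type u := ∀ i, Set (m i).ord.ToType
  let B : W → ρ.ord.ToType → LinOrd.{u} := fun w ζ => P (c ζ) (w (c ζ))
  let Q : W → LinOrd.{u} := fun w => blockSum (B w)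
  have hB : ∀ w ζ, κ ≤ Order.cof (B w ζ) := fun w ζ =>
    (hm _).2.1.le.trans_eq (hP1 (c ζ) (w (c ζ))).1.symm
  have hQcof : ∀ w, Order.cof (Q w) = ρ :=
    fun w => cof_blockSum_regular hρ fun ζ => hκ.aleph0_le.trans (hB w ζ)
  have hQmk : ∀ w, #(Q w) = lam := by
    refine fun w => le_antisymm (mk_blockSum_le hlam ((mk_ord_toType _).trans_le hρlam)
      fun ζ => (hP1 _ _).2.trans_le (hm _).2.2) ?_
    by_contra! hlt
    obtain ⟨i, hi⟩ := hcov _ hlt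
    obtain ⟨δ, hδ, -⟩ := hc i id
    have : c δ = i := hδ
    have h1 := mk_le_mk_blockSum (L := B w) δ
    rw [(hP1 _ _).2, this] at h1
    exact h1.not_gt hi
  have hQ : ∀ w w', w ≠ w' → Incompatible κ (Q w) (Q w') := by
    intro w w' hw
    obtain ⟨i, hi⟩ := Function.ne_iff.1 hw
    refine incompatible_blockSum hκ hρ (hB w) (hB w') ((hc i).mono fun δ hδ => ?_)
    have : c δ = i := hδ
    subst this
    exact hP2 _ _ _ hi
  have hκQ : ∀ w, κ ≤ Order.cof (Q w) := fun w => hκρ.le.trans_eq (hQcof w).symm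
  have hcof : ∀ w θ, θ.IsRegular → Order.cof (blockSum fun _ : θ.ord.ToType => Q w) = θ :=
    fun w θ hθ => cof_blockSum_regular hθ fun _ => hκ.aleph0_le.trans (hκQ w)
  refine ⟨W, fun w θ => blockSum fun _ : θ.ord.ToType => Q w, ?_, fun w θ hθ hκθ hθlam =>
    ⟨hcof w θ hθ, le_antisymm ?_ ?_⟩, fun w w' θ θ' hw hθ hκθ hθ' hκθ' => ?_⟩
  · have hsum : Cardinal.sum m = lam := by
      refine le_antisymm ((Cardinal.sum_le_sum _ (fun _ => lam) fun i => (hm i).2.2).trans ?_) ?_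
      · rw [sum_const, lift_id, lift_id, mk_ord_toType]
        exact mul_le_of_le hlam hρlam le_rfl
      · by_contra! hlt
        obtain ⟨i, hi⟩ := hcov _ hlt
        exact (Cardinal.le_sum m i).not_gt hi
    simp only [W, mk_pi, mk_set, mk_ord_toType]
    rw [← hsum, power_sum]
  · exact mk_blockSum_le hlam ((mk_ord_toType _).trans_le hθlam) fun _ => (hQmk w).le
  · obtain ⟨ζ⟩ := nonempty_of_aleph0_le_cof (hθ.aleph0_le.trans_eq (cof_ord_toType hθ).symm)
    exact (hQmk w).symm.trans_le (mk_le_mk_blockSum (L := fun _ : θ.ord.ToType => Q w) ζ)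
  · by_cases hne : θ = θ'
    · subst hne
      exact incompatible_blockSum hκ hθ (fun _ => hκQ w) (fun _ => hκQ w')
        ((stationaryAt_univ hκ hθ hκθ).mono fun _ _ => hQ w w' hw)
    · exact incompatible_of_cof_ne (hθ.aleph0_le.trans_eq (hcof w θ hθ).symm)
        (hθ'.aleph0_le.trans_eq (hcof w' θ' hθ').symm) (by rwa [hcof w θ hθ, hcof w' θ' hθ'])

/-! ### Cuts of cofinality `κ` -/

/-- The first `κ` elements of a set `U` of size at least `κ` in a well-order have a supremum of
cofinality `κ`. -/
theorem exists_cof_eq_of_le_mk {κ : Cardinal.{u}} (hκ : κ.IsRegular) {Z : Type u} [LinearOrder Z]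
    [WellFoundedLT Z] {U : Set Z} (hU : κ ≤ #U) {z : Z} (hz : ∀ x ∈ U, x < z) :
    ∃ δ, Order.cof (Set.Iio δ) = κ ∧ (∃ᶠ ζ : Set.Iio δ in Filter.atTop, ζ.1 ∈ U) ∧
      ∀ x ∈ U, x < δ ↔ #{y | y ∈ U ∧ y < x} < κ := by
  let U' : Set Z := {x | x ∈ U ∧ #{y | y ∈ U ∧ y < x} < κ}
  have hU' : κ ≤ #U' := by
    by_cases h : U ⊆ U'
    · exact hU.trans (mk_le_mk_of_subset h)
    · obtain ⟨x₀, hx₀, hx₀'⟩ := Set.not_subset.1 h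
      obtain ⟨x, ⟨hx, hx'⟩, hmin⟩ := WellFounded.has_min (wellFounded_lt (α := Z)) (U \ U')
        ⟨x₀, hx₀, hx₀'⟩
      have h1 : κ ≤ #{y | y ∈ U ∧ y < x} := by
        by_contra! h2
        exact hx' ⟨hx, h2⟩
      refine h1.trans (mk_le_mk_of_subset fun y hy => ?_)
      by_contra hn
      exact hmin y ⟨hy.1, hn⟩ hy.2
  obtain ⟨δ, hδ, hmin⟩ := WellFounded.has_min (wellFounded_lt (α := Z)) {z | ∀ x ∈ U', x < z}
    ⟨z, fun x hx => hz x hx.1⟩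
  have hδ' : ∀ ζ < δ, ∃ x ∈ U', ζ ≤ x := by
    intro ζ hζ
    by_contra! h
    exact hmin ζ h hζ
  have hcofinal : IsCofinal {ζ : Set.Iio δ | ζ.1 ∈ U'} := fun ζ => by
    obtain ⟨x, hx, hζx⟩ := hδ' ζ.1 ζ.2
    exact ⟨⟨x, hδ x hx⟩, hx, hζx⟩
  have hseg : ∀ x ∈ U', #{y | y ∈ U' ∧ y < x} < κ := fun x hx =>
    (mk_le_mk_of_subset fun _ hy => And.intro hy.1.1 hy.2).trans_lt hx.2
  refine ⟨δ, le_antisymm ?_ (Order.le_cof_iff.2 fun s hs => ?_), ?_, fun x hx => ⟨?_, ?_⟩⟩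
  · have h1 : #{ζ : Set.Iio δ | ζ.1 ∈ U'} ≤ #U' :=
      mk_le_of_injective (f := fun ζ => (⟨ζ.1.1, ζ.2⟩ : U'))
        fun ζ ζ' h => Subtype.ext (Subtype.ext (congrArg (fun x : U' => x.1) h))
    refine (Order.cof_le hcofinal).trans (h1.trans ?_)
    have h2 : Ordinal.type (α := U') (· < ·) ≤ κ.ord := by
      by_contra! hlt
      obtain ⟨x, hx⟩ := Ordinal.typein_surj (α := U') (· < ·) hlt
      have h3 : #(Set.Iio x) = κ := by
        have := congrArg Ordinal.card hx
        rwa [card_ord] at this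
      refine (hseg x.1 x.2).not_ge (h3.symm.trans_le ?_)
      exact mk_le_of_injective (f := fun y => (⟨y.1.1, y.1.2, y.2⟩ : {y | y ∈ U' ∧ y < x.1}))
        fun y y' h => Subtype.ext (Subtype.ext
          (congrArg (fun x : {y | y ∈ U' ∧ y < x.1} => x.1) h))
    have := Ordinal.card_le_card h2
    rwa [card_ord, Ordinal.card_type] at this
  · by_contra! hlt
    have h1 : #(⋃ ζ : s, {y | y ∈ U' ∧ y ≤ ζ.1.1}) < κ := by
      refine (card_iUnion_lt_iff_forall_of_isRegular hκ hlt).2 fun ζ => ?_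
      obtain ⟨x, hx, hζx⟩ := hδ' ζ.1.1 ζ.1.2
      have : {y | y ∈ U' ∧ y ≤ ζ.1.1} ⊆ insert x {y | y ∈ U' ∧ y < x} := fun y hy => by
        rcases (hy.2.trans hζx).eq_or_lt with h | h
        · exact .inl h
        · exact .inr ⟨hy.1, h⟩
      exact (mk_le_mk_of_subset this).trans_lt (mk_insert_le.trans_lt
        (add_lt_of_lt hκ.aleph0_le (hseg x hx) (one_lt_aleph0.trans_le hκ.aleph0_le)))
    refine (hU'.trans (mk_le_mk_of_subset fun x hx => ?_)).not_gt h1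
    obtain ⟨ζ, hζ, hxζ⟩ := hs ⟨x, hδ x hx⟩
    exact Set.mem_iUnion.2 ⟨⟨ζ, hζ⟩, hx, hxζ⟩
  · obtain ⟨x, hx⟩ : U'.Nonempty := by
      rw [Set.nonempty_iff_ne_empty]
      rintro h
      rw [h, mk_eq_zero] at hU'
      exact (hκ.pos.trans_le hU').false
    have : Nonempty (Set.Iio δ) := ⟨⟨x, hδ x hx⟩⟩
    refine Filter.frequently_atTop.2 fun ζ => ?_
    obtain ⟨x, hx, hζx⟩ := hcofinal ζ
    exact ⟨x, hζx, hx.1⟩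
  · intro hxδ
    obtain ⟨x', hx', hle⟩ := hδ' x hxδ
    exact (mk_le_mk_of_subset fun _ hy => And.intro hy.1 (hy.2.trans_le hle)).trans_lt hx'.2
  · exact fun h => hδ x ⟨hx, h⟩

/-! ### Families of skeletons inside one relation -/

/-- Linear orders `L w θ` of size `lam` and of prescribed cofinality `θ`, incompatible for
different `w`. -/
structure IsCodeFamily (κ lam : Cardinal.{u}) {W : Type u} (L : W → Cardinal.{u} → LinOrd.{u}) :
    Prop where
  cof_eq : ∀ w θ, θ.IsRegular → κ < θ → θ ≤ lam → Order.cof (L w θ) = θ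
  mk_eq : ∀ w θ, θ.IsRegular → κ < θ → θ ≤ lam → #(L w θ) = lam
  incompatible : ∀ w w' θ θ', w ≠ w' → θ.IsRegular → κ < θ → θ'.IsRegular → κ < θ' →
        Incompatible κ (L w θ) (L w' θ')

theorem IsCodeFamily.comp {κ lam : Cardinal.{u}} {W T : Type u}
    {L : W → Cardinal.{u} → LinOrd.{u}} (h : IsCodeFamily κ lam L) {g : T → W}
    (hg : Function.Injective g) : IsCodeFamily κ lam fun t => L (g t) where
  cof_eq _ := h.cof_eq _
  mk_eq _ := h.mk_eq _
  incompatible _ _ _ _ hne := h.incompatible _ _ _ _ (hg.ne hne)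

theorem exists_isCodeFamily {κ lam : Cardinal.{u}} (hκ : κ.IsRegular) (h : κ < lam) :
    ∃ L : (2 ^ lam : Cardinal.{u}).out → Cardinal.{u} → LinOrd.{u}, IsCodeFamily κ lam L := by
  obtain ⟨W, L, hW, h1, h2⟩ := exists_codes hκ h
  obtain ⟨e⟩ : Nonempty ((2 ^ lam : Cardinal.{u}).out ≃ W) := Cardinal.eq.1 (by rw [mk_out, hW])
  have hL : IsCodeFamily κ lam L := ⟨fun w θ h3 h4 h5 => (h1 w θ h3 h4 h5).1,
    fun w θ h3 h4 h5 => (h1 w θ h3 h4 h5).2, h2⟩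
  exact ⟨_, hL.comp e.injective⟩

theorem IsCodeFamily.mk_blockSum {κ lam : Cardinal.{u}} (hlam : ℵ₀ ≤ lam) {W : Type u}
    {L : W → Cardinal.{u} → LinOrd.{u}} (hL : IsCodeFamily κ lam L) {Z : Type u} [LinearOrder Z]
    [Nonempty Z] (hZ : #Z ≤ lam) (w : W) {h : Z → Cardinal.{u}}
    (hh : ∀ ζ, (h ζ).IsRegular ∧ κ < h ζ ∧ h ζ ≤ lam) :
    #(blockSum fun ζ => L w (h ζ)) = lam := by
  have h1 : ∀ ζ, #(L w (h ζ)) = lam := fun ζ => hL.mk_eq _ _ (hh ζ).1 (hh ζ).2.1 (hh ζ).2.2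
  refine (mk_blockSum_le hlam hZ fun ζ => (h1 ζ).le).antisymm ?_
  exact (h1 (Classical.arbitrary Z)).symm.trans_le
    (mk_le_mk_blockSum (L := fun ζ => L w (h ζ)) (Classical.arbitrary Z))

section

variable {κ lam : Cardinal.{u}} {W : Type u} {L : W → Cardinal.{u} → LinOrd.{u}}
  {V : Type u} {R : V → V → Prop}

open Filter in
/-- The average over `B` of a cut approached inside `B` determines the code. -/
theorem IsCodeFamily.eq_of_agree (hL : IsCodeFamily κ lam L) (hκ : κ.IsRegular)
    (hR : ∀ x y, R x y → ¬ R y x) {Z : Type u} [LinearOrder Z] {w w' : W}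
    {h h' : Z → Cardinal.{u}} (hh : ∀ ζ, (h ζ).IsRegular ∧ κ < h ζ ∧ h ζ ≤ lam)
    (hh' : ∀ ζ, (h' ζ).IsRegular ∧ κ < h' ζ ∧ h' ζ ≤ lam)
    {a : (blockSum fun ζ => L w (h ζ)) → V} {b : (blockSum fun ζ => L w' (h' ζ)) → V}
    (ha : IsSkeleton κ R a) (hb : IsSkeleton κ R b) {δ δ' : Z}
    (hδ : Order.cof (Set.Iio δ) = κ) (hδ' : Order.cof (Set.Iio δ') = κ)
    (f : ∀ ζ, L w (h ζ)) (f' : ∀ ζ, L w' (h' ζ)) (B : Set V)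
    (hB : ∃ᶠ ζ : Set.Iio δ in atTop, a (pt _ ζ (f ζ)) ∈ B)
    (hB' : ∃ᶠ ζ : Set.Iio δ' in atTop, b (pt _ ζ (f' ζ)) ∈ B)
    (hJ : ∃ J : Set (blockSum fun ζ => L w (h ζ)), #J < h δ ∧
      ∀ c ∈ B, DependsOn J fun s => R c (a s))
    (hJ' : ∃ J : Set (blockSum fun ζ => L w' (h' ζ)), #J < h' δ' ∧
      ∀ c ∈ B, DependsOn J fun s => R c (b s))
    (hq : ∀ c ∈ B, (∀ᶠ ζ : Set.Iio δ in atTop, R c (a (pt _ ζ (f ζ)))) ↔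
      ∀ᶠ ζ : Set.Iio δ' in atTop, R c (b (pt _ ζ (f' ζ)))) : w = w' := by
  by_contra hne
  have h1 := hL.cof_eq w _ (hh δ).1 (hh δ).2.1 (hh δ).2.2
  have h2 := hL.cof_eq w' _ (hh' δ').1 (hh' δ').2.1 (hh' δ').2.2
  refine hL.incompatible w w' (h δ) (h' δ') hne (hh δ).1 (hh δ).2.1 (hh' δ').1 (hh' δ').2.1 V
    (fun x y => R y x) _ _ (fun x y hxy => hR y x hxy) (ha.block δ) (hb.block δ')
    (endsMatch_of_agree hκ.aleph0_le ha hb hδ.ge ((hh δ).2.1.le.trans_eq h1.symm) hδ'.ge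
      ((hh' δ').2.1.le.trans_eq h2.symm) f f' B hB hB' ?_ ?_ hq)
  · rwa [h1]
  · rwa [h2]

/-- If every large subset of `V` includes a member of `P` of size `κ`, then at most `#P` skeletons
with different codes fit into one relation: the first `κ` elements of a member of `P` are recognized
from `R` alone, and a cut which they approach determines the code. -/
theorem IsCodeFamily.mk_le_of_dense (hL : IsCodeFamily κ lam L) (hκ : κ.IsRegular) (hlam : κ < lam)
    (hR : ∀ x y, R x y → ¬ R y x)
    (a : ∀ w, (blockSum fun _ : WithTop lam.ord.ToType => L w (Order.succ κ)) → V)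
    (ha : ∀ w, IsSkeleton κ R (a w)) (P : Set (Set V)) (hP : ∀ p ∈ P, #p = κ)
    (hP' : ∀ X : Set V, #X = lam → ∃ p ∈ P, p ⊆ X) : #W ≤ #P := by
  have hsucc : (Order.succ κ).IsRegular ∧ κ < Order.succ κ ∧ Order.succ κ ≤ lam :=
    ⟨isRegular_succ hκ.aleph0_le, Order.lt_succ κ, Order.succ_le_of_lt hlam⟩
  have hne : ∀ w, Nonempty (L w (Order.succ κ)) := fun w =>
    nonempty_of_aleph0_le_cof (by
      rw [hL.cof_eq w _ hsucc.1 hsucc.2.1 hsucc.2.2]; exact hsucc.1.aleph0_le)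
  let f : ∀ w, WithTop lam.ord.ToType → V := fun w ζ => a w (pt _ ζ (hne w).some)
  have hmono : ∀ w, StrictMono fun ζ => pt _ ζ (hne w).some :=
    fun w => strictMono_pt (L := fun _ : WithTop lam.ord.ToType => L w (Order.succ κ)) _
  have hf : ∀ w ζ ζ', R (f w ζ) (f w ζ') ↔ ζ < ζ' :=
    fun w ζ ζ' => ((ha w).rel_iff _ _).trans (hmono w).lt_iff_lt
  have hfinj : ∀ w, Function.Injective (f w) :=
    fun w => (ha w).injective.comp (hmono w).injective
  have hp : ∀ w, ∃ p ∈ P, p ⊆ Set.range fun ζ : lam.ord.ToType => f w ζ := fun w =>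
    hP' _ ((mk_range_eq _ ((hfinj w).comp WithTop.coe_injective)).trans (mk_ord_toType _))
  choose p hpP hp using hp
  refine mk_le_of_injective (f := fun w => (⟨p w, hpP w⟩ : P)) fun w w' hww' => ?_
  have hpp : p w = p w' := congrArg Subtype.val hww'
  let B : Set V := {v | v ∈ p w ∧ #{v' | v' ∈ p w ∧ R v' v} < κ}
  have main : ∀ w', p w' = p w → ∃ δ, Order.cof (Set.Iio δ) = κ ∧
      (∃ᶠ ζ : Set.Iio δ in Filter.atTop, f w' ζ.1 ∈ B) ∧
      ∀ c ∈ B, ∀ᶠ ζ : Set.Iio δ in Filter.atTop, R c (f w' ζ.1) := by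
    intro w' hw'
    have hr : ∀ v ∈ p w, ∃ ζ, f w' ζ = v ∧ ζ < ⊤ := fun v hv => by
      obtain ⟨ζ, hζ⟩ := hp w' (hw' ▸ hv)
      exact ⟨ζ, hζ, WithTop.coe_lt_top _⟩
    let U : Set (WithTop lam.ord.ToType) := {ζ | f w' ζ ∈ p w}
    have hUtop : ∀ ζ ∈ U, ζ < ⊤ := fun ζ hζ => by
      obtain ⟨ξ, hξ, hξ'⟩ := hr _ hζ
      exact hfinj w' hξ ▸ hξ'
    have hUmk : ∀ D : V → Prop, #{v | v ∈ p w ∧ D v} = #{ζ | ζ ∈ U ∧ D (f w' ζ)} := by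
      intro D
      refine (mk_image_eq (s := {ζ | ζ ∈ U ∧ D (f w' ζ)}) (hfinj w')).symm.trans ?_ |>.symm
      congr 2
      ext v
      constructor
      · rintro ⟨ζ, ⟨h1, h2⟩, rfl⟩
        exact ⟨h1, h2⟩
      · rintro ⟨h1, h2⟩
        obtain ⟨ζ, rfl, -⟩ := hr v h1
        exact ⟨ζ, ⟨h1, h2⟩, rfl⟩
    have hU : κ ≤ #U := by
      have := hUmk fun _ => True
      simp only [and_true] at this
      exact (hP _ (hpP w)).symm.trans_le this.le
    obtain ⟨δ, hδ, hfr, hiff⟩ := exists_cof_eq_of_le_mk hκ hU hUtop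
    have hB : ∀ ζ ∈ U, f w' ζ ∈ B ↔ ζ < δ := by
      intro ζ hζ
      rw [hiff ζ hζ]
      refine (and_iff_right hζ).trans ?_
      rw [hUmk fun v' => R v' (f w' ζ)]
      simp only [hf]
    refine ⟨δ, hδ, hfr.mono fun ζ hζ => (hB _ hζ).2 ζ.2, fun c hc => ?_⟩
    obtain ⟨ζ, rfl, -⟩ := hr c hc.1
    have hζ := (hB ζ hc.1).1 hc
    have := noMaxOrder_of_aleph0_le_cof (hκ.aleph0_le.trans_eq hδ.symm)
    exact (Filter.eventually_gt_atTop (⟨ζ, hζ⟩ : Set.Iio δ)).mono fun ξ hξ =>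
      (hf w' _ _).2 (Subtype.coe_lt_coe.2 hξ)
  have hJ : ∀ w', ∃ J : Set (blockSum fun _ : WithTop lam.ord.ToType => L w' (Order.succ κ)),
      #J < Order.succ κ ∧ ∀ c ∈ B, DependsOn J fun s => R c (a w' s) := by
    intro w'
    obtain ⟨J, hJ, hD⟩ := exists_common_support hκ.aleph0_le
      (fun _ _ _ hJ hD => hD.mono hJ) (ha w').left B
    refine ⟨J, Order.lt_succ_of_le (hJ.trans (max_le ?_ le_rfl)), hD⟩
    exact (mk_le_mk_of_subset fun v hv => hv.1).trans_eq (hP _ (hpP w))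
  obtain ⟨δ, hδ, hfr, hev⟩ := main w rfl
  obtain ⟨δ', hδ', hfr', hev'⟩ := main w' hpp.symm
  exact hL.eq_of_agree hκ hR (fun _ => hsucc) (fun _ => hsucc) (ha w) (ha w') hδ hδ'
    (fun _ => (hne w).some) (fun _ => (hne w').some) B hfr hfr' (hJ w) (hJ w')
    fun c hc => iff_of_true (hev c hc) (hev' c hc)

/-- If `V` is the union of an increasing `lam`-sequence of sets `B i` such that the relations to
members of `B i` depend on fewer than `lam` elements of each skeleton, then at most `max #V lam`
skeletons with different codes fit into one relation: some cut is approached by members of some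
`B i`, its average over `B i` is realized, and the cut together with the realization determines the
code. -/
theorem IsCodeFamily.mk_le_of_filtration (hL : IsCodeFamily κ lam L) (hκ : κ.IsRegular)
    (hR : ∀ x y, R x y → ¬ R y x) {ρ : Cardinal.{u}} (hρ : ρ.IsRegular) (hκρ : κ < ρ)
    (hρlam : ρ ≤ lam) {m : ρ.ord.ToType → Cardinal.{u}}
    (hm : ∀ i, (m i).IsRegular ∧ κ < m i ∧ m i ≤ lam) (hcov : ∀ c < lam, ∃ i, c < m i)
    (hcase : (ρ = lam ∧ ∀ i, m i = lam) ∨ lam.ord.cof < ρ)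
    {c : ρ.ord.ToType → ρ.ord.ToType} (hc : ∀ i, StationaryAt κ (c ⁻¹' {i}))
    (a : ∀ w, (blockSum fun ζ => L w (m (c ζ))) → V) (ha : ∀ w, IsSkeleton κ R (a w))
    (B : lam.ord.ToType → Set V) (hBmono : Monotone B) (hBcov : ∀ v, ∃ i, v ∈ B i)
    (hB : ∀ w i, ∃ J : Set (blockSum fun ζ => L w (m (c ζ))), #J < lam ∧
      ∀ v ∈ B i, DependsOn J fun s => R v (a w s)) : #W ≤ max #V lam := by
  have hlam : ℵ₀ ≤ lam := hκ.aleph0_le.trans (hκρ.le.trans hρlam)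
  have hcof := cof_ord_toType hρ
  have hLcof : ∀ w i, Order.cof (L w (m i)) = m i :=
    fun w i => hL.cof_eq w _ (hm i).1 (hm i).2.1 (hm i).2.2
  have hne : ∀ w ζ, Nonempty (L w (m (c ζ))) := fun w ζ => nonempty_of_aleph0_le_cof (by
    rw [hLcof]; exact (hm _).1.aleph0_le)
  let f : ∀ w ζ, L w (m (c ζ)) := fun w ζ => (hne w ζ).some
  have hcut : ∀ w, ∃ (δ : ρ.ord.ToType) (i : lam.ord.ToType), Order.cof (Set.Iio δ) = κ ∧
      (∃ᶠ ζ : Set.Iio δ in Filter.atTop, a w (pt _ ζ (f w ζ)) ∈ B i) ∧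
      ∃ J : Set (blockSum fun ζ => L w (m (c ζ))), #J < m (c δ) ∧
        ∀ v ∈ B i, DependsOn J fun s => R v (a w s) := by
    intro w
    choose g hg using fun ζ => hBcov (a w (pt _ ζ (f w ζ)))
    rcases hcase with ⟨rfl, hm'⟩ | hlt
    -- If `lam` is regular, then a point `δ` closed under `g` has its lower half inside `B δ`.
    · obtain ⟨δ, -, hδ, hcl⟩ := stationaryAt_univ hκ hρ hκρ g
      have := nonempty_of_aleph0_le_cof (hκ.aleph0_le.trans_eq hδ.symm)
      refine ⟨δ, δ, hδ, Filter.Eventually.frequently (.of_forall fun ζ =>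
        hBmono (hcl ζ.1 ζ.2).le (hg _)), ?_⟩
      rw [hm']
      exact hB w δ
    -- If `cf lam < ρ`, then a single `B i` contains the points of cofinally many blocks, and `δ` is
    -- taken where the upper cofinality exceeds the support of `B i`.
    · obtain ⟨s, hs, hs'⟩ := Order.exists_cof_eq lam.ord.ToType
      rw [Ordinal.cof_toType] at hs'
      choose e he hge using fun ζ => hs (g ζ)
      obtain ⟨i, hi⟩ := isCofinal_of_isCofinal_iUnion (s := fun i : s => {ζ | e ζ = i})
        (fun ζ => ⟨ζ, Set.mem_iUnion.2 ⟨⟨e ζ, he ζ⟩, rfl⟩, le_rfl⟩)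
        (by rwa [hs', hcof])
      obtain ⟨J, hJ, hD⟩ := hB w i
      obtain ⟨j, hj⟩ := hcov _ hJ
      have := noMaxOrder_of_aleph0_le_cof (hρ.aleph0_le.trans_eq hcof.symm)
      have hF : ∀ ζ : ρ.ord.ToType, ∃ ξ, ζ < ξ ∧ e ξ = i := fun ζ => by
        obtain ⟨ζ', h1⟩ := exists_gt ζ
        obtain ⟨ξ, h2, h3⟩ := hi ζ'
        exact ⟨ξ, h1.trans_le h3, h2⟩
      choose F hF hF' using hF
      obtain ⟨δ, hδj, hδ, hcl⟩ := hc j F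
      have := nonempty_of_aleph0_le_cof (hκ.aleph0_le.trans_eq hδ.symm)
      refine ⟨δ, i, hδ, Filter.frequently_atTop.2 fun ζ =>
        ⟨⟨F ζ, hcl _ ζ.2⟩, (hF ζ).le, ?_⟩, J, ?_, hD⟩
      · exact hBmono ((hge _).trans_eq (hF' ζ)) (hg _)
      · have : c δ = j := hδj
        rwa [this]
  choose δ i hδ hfr hJ using hcut
  have hv : ∀ w, ∃ v, ∀ x ∈ B (i w),
      (∀ᶠ ζ : Set.Iio (δ w) in Filter.atTop, R x (a w (pt _ ζ (f w ζ)))) ↔ R x v := by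
    intro w
    obtain ⟨J, hJ, hD⟩ := hJ w
    obtain ⟨l₀, hl₀⟩ := exists_forall_block_iff (L := fun ζ => L w (m (c ζ))) (J := J)
      (δ := δ w) (by rwa [hLcof])
    refine ⟨a w (pt _ _ l₀), fun x hx => ?_⟩
    obtain ⟨J', hJ', hD'⟩ := (ha w).left x
    rw [hD'.eventually_cut_iff hκ.aleph0_le hJ' (hδ w).ge
      ((hm _).2.1.le.trans_eq (hLcof w _).symm) (f w)]
    have := hne w (δ w)
    constructor
    · intro h
      obtain ⟨l, hl, hl'⟩ := ((Filter.eventually_ge_atTop l₀).and h).exists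
      exact (hl₀ l hl _ (hD x hx)).1 hl'
    · exact fun h => (Filter.eventually_ge_atTop l₀).mono fun l hl => (hl₀ l hl _ (hD x hx)).2 h
  choose v hv using hv
  have hinj : Function.Injective fun w => (v w, δ w, i w) := by
    intro w w' h
    simp only [Prod.mk.injEq] at h
    obtain ⟨h1, h2, h3⟩ := h
    refine hL.eq_of_agree hκ hR (fun _ => hm _) (fun _ => hm _) (ha w) (ha w') (hδ w) (hδ w')
      (f w) (f w') (B (i w)) (hfr w) ?_ (hJ w) ?_ fun x hx => ?_
    · rw [h3]; exact hfr w'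
    · rw [h3]; exact hJ w'
    · rw [hv w x hx, hv w' x (h3 ▸ hx), h1]
  refine (mk_le_of_injective hinj).trans ?_
  simp only [mk_prod, lift_id, mk_ord_toType]
  exact mul_le_of_le (le_max_of_le_right hlam) (le_max_left _ _)
    (mul_le_of_le (le_max_of_le_right hlam) (le_max_of_le_right hρlam) (le_max_right _ _))

end

/-! ### Skeletons inside models -/

section

variable {L : FirstOrder.Language.{v, w}} {ι : Type u} (φ : Formula L ι) (M : Model.{u} L)

/-- The asymmetric relation `φ(x̄, ȳ) ∧ ¬ φ(ȳ, x̄)` on the `ι`-sequences of `M`. -/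
def strictRel (x y : ι → M) : Prop := φ.Sat M x y ∧ ¬ φ.Sat M y x

theorem strictRel_asymm (x y : ι → M) (h : strictRel φ M x y) : ¬ strictRel φ M y x :=
  fun h' => h.2 h'.1

/-- The part common to both notions of weakly skeleton like sequences. Asymmetry of `φ` is not
included, since `strictRel` replaces `φ`. -/
structure IsOrderedSkeleton (κ : Cardinal.{u}) {I : Type u} [LinearOrder I] (a : I → ι → M) :
    Prop where
  sat_iff : ∀ s t, φ.Sat M (a s) (a t) ↔ s < t
  determines : ∀ c, ∃ J : Set I, #J < κ ∧ Determines φ M a J c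

variable {φ M} {I : Type u} [LinearOrder I] {a : I → ι → M} {κ : Cardinal.{u}}

theorem Determines.dependsOn {J : Set I} {c : ι → M} (h : Determines φ M a J c) (k : Bool) :
    DependsOn J fun s => SatInst φ M k (a s) c := h k

theorem Determines.dependsOn_strictRel {J : Set I} {c : ι → M} (h : Determines φ M a J c) :
    DependsOn J fun s => strictRel φ M c (a s) :=
  (h.dependsOn false).and_not (h.dependsOn true)

theorem IsOrderedSkeleton.isSkeleton (h : IsOrderedSkeleton φ M κ a) :
    IsSkeleton κ (strictRel φ M) a where
  rel_iff s t := by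
    simp only [strictRel, h.sat_iff]
    exact ⟨fun h => h.1, fun h => ⟨h, h.not_gt⟩⟩
  left c :=
    let ⟨J, hJ, hD⟩ := h.determines c
    ⟨J, hJ, hD.dependsOn_strictRel⟩
  right c :=
    let ⟨J, hJ, hD⟩ := h.determines c
    ⟨J, hJ, (hD.dependsOn true).and_not (hD.dependsOn false)⟩

theorem IsOrderedSkeleton.exists_determines (h : IsOrderedSkeleton φ M κ a) (hκ : ℵ₀ ≤ κ)
    (B : Set (ι → M)) : ∃ J : Set I, #J ≤ max #B κ ∧ ∀ c ∈ B, Determines φ M a J c :=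
  exists_common_support hκ (fun _ _ _ hJ hD k => (hD.dependsOn k).mono hJ) h.determines B

theorem WeaklySkeletonLike.isOrderedSkeleton (h : WeaklySkeletonLike φ M κ a) :
    IsOrderedSkeleton φ M κ a := ⟨h.2.2, h.2.1⟩

theorem WeaklySkeletonLike₃.isOrderedSkeleton {μ θ : Cardinal.{u}}
    (h : WeaklySkeletonLike₃ φ M κ μ θ a) : IsOrderedSkeleton φ M κ a := ⟨h.1, h.2.1⟩

/-! ### Invariance under isomorphisms -/

variable {N : Model.{u} L} (e : L.Equiv M N)


theorem satInst_equiv (k : Bool) (x y : ι → M) :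
    SatInst φ N k (fun i => e (x i)) (fun i => e (y i)) ↔ SatInst φ M k x y := by
  cases k
  · exact (φ.sat_equiv M N e y x).symm
  · exact (φ.sat_equiv M N e x y).symm

theorem determines_equiv {J : Set I} {c : ι → N} :
    Determines φ N (fun s i => e (a s i)) J c ↔ Determines φ M a J fun i => e.symm (c i) := by
  have hc : c = fun i => e (e.symm (c i)) := funext fun i => (e.apply_symm_apply _).symm
  rw [hc]
  simp only [Determines, satInst_equiv, FirstOrder.Language.Equiv.symm_apply_apply]

theorem IsOrderedSkeleton.equiv (h : IsOrderedSkeleton φ M κ a) :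
    IsOrderedSkeleton φ N κ fun s i => e (a s i) where
  sat_iff s t := (φ.sat_equiv M N e (a s) (a t)).symm.trans (h.sat_iff s t)
  determines c :=
    let ⟨J, hJ, hD⟩ := h.determines fun i => e.symm (c i)
    ⟨J, hJ, (determines_equiv e).2 hD⟩

theorem WeaklySkeletonLike₃.equiv {μ θ : Cardinal.{u}} (h : WeaklySkeletonLike₃ φ M κ μ θ a) :
    WeaklySkeletonLike₃ φ N κ μ θ fun s i => e (a s i) := by
  have h' := h.isOrderedSkeleton.equiv e
  refine ⟨h'.1, h'.2, fun A hA => ?_⟩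
  obtain ⟨J, hJ, hD⟩ := h.2.2 (e ⁻¹' A)
    ((mk_preimage_of_injective _ _ e.injective).trans_lt hA)
  refine ⟨J, hJ, fun c hc => (determines_equiv e).2 (hD _ fun i => ?_)⟩
  simpa using hc i

end

/-! ### Few types -/

section

variable {L : FirstOrder.Language.{v, w}} {ι : Type u} {φ : Formula L ι} {M : Model.{u} L}
  {κ lam : Cardinal.{u}}

/-- The average over `A` of the lower half of a cut approached inside `A` is well defined, as each
instance depends on fewer than `κ` elements. It is realized by elements of the upper half if the
upper cofinality exceeds the support of `A`, so it is also a type over `A`. -/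
theorem average_mem (hκ : κ.IsRegular) {Z : Type u} [LinearOrder Z] [WellFoundedLT Z]
    {P : Z → LinOrd.{u}} {a : blockSum P → ι → M} (ha : IsOrderedSkeleton φ M κ a) {δ : Z}
    (hδ : Order.cof (Set.Iio δ) = κ) (hP : κ ≤ Order.cof (P δ)) (f : ∀ ζ, P ζ) (A : Set M)
    (hA : ∃ᶠ ζ : Set.Iio δ in Filter.atTop, ∀ j, a (pt P ζ (f ζ)) j ∈ A)
    (hJ : ∃ J : Set (blockSum P), #J < Order.cof (P δ) ∧
      ∀ c : ι → M, (∀ j, c j ∈ A) → Determines φ M a J c) :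
    {q | ∀ᶠ ζ : Set.Iio δ in Filter.atTop, SatSigned φ M (a (pt P ζ (f ζ))) q} ∈
      realizedAverages φ M κ A ∩ typesOver φ M A := by
  have hne := nonempty_of_aleph0_le_cof (hκ.aleph0_le.trans_eq hδ.symm)
  have hneP := nonempty_of_aleph0_le_cof (hκ.aleph0_le.trans hP)
  have hdep : ∀ (J : Set (blockSum P)) (q : SignedInst ι A),
      Determines φ M a J (fun i => (q.2.1 i : M)) → DependsOn J fun s => SatSigned φ M (a s) q :=
    fun J q hJ s t hst => iff_congr (hJ q.1 s t hst) Iff.rfl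
  have hcut : ∀ q : SignedInst ι A, ∃ J : Set (blockSum P), #J < κ ∧
      DependsOn J fun s => SatSigned φ M (a s) q := fun q =>
    let ⟨J, hJ, hD⟩ := ha.determines fun i => (q.2.1 i : M)
    ⟨J, hJ, hdep J q hD⟩
  obtain ⟨t, htA, ht, htype⟩ := Ordinal.exists_ord_cof_eq_of_isCofinal
    (s := {ζ : Set.Iio δ | ∀ j, a (pt P ζ (f ζ)) j ∈ A}) fun ζ =>
      let ⟨ξ, h1, h2⟩ := Filter.frequently_atTop.1 hA ζ
      ⟨ξ, h2, h1⟩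
  rw [hδ, ← Ordinal.type_toType κ.ord] at htype
  obtain ⟨g⟩ := Ordinal.type_eq.1 htype.symm
  let g' : κ.ord.ToType ≃o t := OrderIso.ofRelIsoLT g
  let b : κ.ord.ToType → ι → M := fun i => a (pt P (g' i).1.1 (f _))
  have hb : ∀ D : blockSum P → Prop, (∀ᶠ ζ : Set.Iio δ in Filter.atTop, D (pt P ζ (f ζ))) →
      ∃ i₀, ∀ i, i₀ ≤ i → D (pt P (g' i).1.1 (f _)) := by
    intro D hD
    obtain ⟨ζ, hζ⟩ := Filter.eventually_atTop.1 hD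
    obtain ⟨ξ, hξ, hle⟩ := ht ζ
    refine ⟨g'.symm ⟨ξ, hξ⟩, fun i hi => hζ _ (hle.trans ?_)⟩
    exact Subtype.coe_le_coe.2 (g'.symm_apply_le.1 hi)
  have hav : ∀ q : SignedInst ι A, q ∈ average φ M A b ↔
      ∀ᶠ ζ : Set.Iio δ in Filter.atTop, SatSigned φ M (a (pt P ζ (f ζ))) q := by
    intro q
    refine ⟨fun h => ?_, hb fun s => SatSigned φ M (a s) q⟩
    obtain ⟨J, hJ, hD⟩ := hcut q
    rcases hD.eventually_cut hJ hδ.ge hP f with h1 | h1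
    · exact h1.1
    · obtain ⟨i₀, h2⟩ := h
      obtain ⟨i₁, h3⟩ := hb (fun s => ¬ SatSigned φ M (a s) q) h1.1
      exact (h3 _ (le_max_right i₀ i₁) (h2 _ (le_max_left i₀ i₁))).elim
  obtain ⟨J, hJ, hD⟩ := hJ
  obtain ⟨l₀, hl₀⟩ := exists_forall_block_iff hJ
  have hreal : ∀ q : SignedInst ι A,
      (∀ᶠ ζ : Set.Iio δ in Filter.atTop, SatSigned φ M (a (pt P ζ (f ζ))) q) ↔
        SatSigned φ M (a (pt P δ l₀)) q := by
    intro q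
    obtain ⟨J', hJ', hD'⟩ := hcut q
    rw [hD'.eventually_cut_iff hκ.aleph0_le hJ' hδ.ge hP f]
    have hq := hdep J q (hD _ fun j => (q.2.1 j).2)
    constructor
    · intro h
      obtain ⟨l, hl, hl'⟩ := ((Filter.eventually_ge_atTop l₀).and h).exists
      exact (hl₀ l hl _ hq).1 hl'
    · exact fun h => (Filter.eventually_ge_atTop l₀).mono fun l hl => (hl₀ l hl _ hq).2 h
  refine ⟨⟨b, fun i j => htA (g' i).2 j, fun k c => ?_, Set.ext fun q => (hav q).symm,
    a (pt P δ l₀), fun q hq => (hreal q).1 hq⟩, a (pt P δ l₀), Set.ext fun q => (hreal q).symm⟩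
  classical
  refine ⟨decide (SatInst φ M k (a (pt P δ l₀)) fun i => (c i : M)), (hav _).2 ((hreal _).2 ?_)⟩
  simp [SatSigned]

/-- In a model with few types, few skeletons with different codes have cuts approached inside a
given small set: the average over that set determines the code. -/
theorem IsCodeFamily.mk_lt_of_fewTypes (hκ : κ.IsRegular) {μ₀ lam₀ : Cardinal.{u}}
    (hfew : FewTypes φ M κ μ₀ lam₀) {A : Set M} (hA : #A < lam₀) {T : Type u}
    {P : T → Cardinal.{u} → LinOrd.{u}} (hP : IsCodeFamily κ lam P) {Z : Type u} [LinearOrder Z]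
    [WellFoundedLT Z] (h : T → Z → Cardinal.{u})
    (hh : ∀ t ζ, (h t ζ).IsRegular ∧ κ < h t ζ ∧ h t ζ ≤ lam)
    (a : ∀ t, (blockSum fun ζ => P t (h t ζ)) → ι → M)
    (ha : ∀ t, IsOrderedSkeleton φ M κ (a t)) (f : ∀ t ζ, P t (h t ζ)) (δ : T → Z)
    (hδ : ∀ t, Order.cof (Set.Iio (δ t)) = κ)
    (haA : ∀ t, ∃ᶠ ζ : Set.Iio (δ t) in Filter.atTop, ∀ j, a t (pt _ ζ (f t ζ)) j ∈ A)
    (hJ : ∀ t, ∃ J : Set (blockSum fun ζ => P t (h t ζ)), #J < h t (δ t) ∧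
      ∀ c : ι → M, (∀ j, c j ∈ A) → Determines φ M (a t) J c) : #T < μ₀ := by
  have hcof : ∀ t ζ, Order.cof (P t (h t ζ)) = h t ζ :=
    fun t ζ => hP.cof_eq t _ (hh t ζ).1 (hh t ζ).2.1 (hh t ζ).2.2
  let p : T → Set (SignedInst ι A) := fun t =>
    {q | ∀ᶠ ζ : Set.Iio (δ t) in Filter.atTop, SatSigned φ M (a t (pt _ ζ (f t ζ))) q}
  have hmem : ∀ t, p t ∈ realizedAverages φ M κ A ∩ typesOver φ M A := fun t =>
    average_mem hκ (ha t) (hδ t) ((hh t _).2.1.le.trans_eq (hcof t _).symm) (f t) A (haA t)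
      (by simpa only [hcof] using hJ t)
  have hev : ∀ t (c : ι → A), (∀ᶠ ζ : Set.Iio (δ t) in Filter.atTop,
      strictRel φ M (fun i => (c i : M)) (a t (pt _ ζ (f t ζ)))) ↔
      (false, c, true) ∈ p t ∧ (true, c, false) ∈ p t := by
    intro t c
    refine Filter.eventually_and.trans (and_congr ?_ ?_) <;>
      simp [p, SatSigned, SatInst]
  have hinj : Function.Injective p := by
    intro t t' htt'
    have hB : ∀ t, (∃ J : Set (blockSum fun ζ => P t (h t ζ)), #J < h t (δ t) ∧
        ∀ c ∈ {c : ι → M | ∀ j, c j ∈ A}, DependsOn J fun s => strictRel φ M c (a t s)) := fun t =>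
      let ⟨J, h1, h2⟩ := hJ t
      ⟨J, h1, fun c hc => (h2 c hc).dependsOn_strictRel⟩
    refine hP.eq_of_agree hκ (strictRel_asymm φ M) (hh t) (hh t') (ha t).isSkeleton
      (ha t').isSkeleton (hδ t) (hδ t') (f t) (f t') {c | ∀ j, c j ∈ A} (haA t) (haA t') (hB t)
      (hB t') fun c hc => ?_
    have h1 := hev t fun i => ⟨c i, hc i⟩
    have h2 := hev t' fun i => ⟨c i, hc i⟩
    rw [← htt'] at h2
    exact h1.trans h2.symm
  rcases hfew A hA with h1 | h1
  · exact (mk_le_of_injective (f := fun t => (⟨p t, (hmem t).2⟩ : typesOver φ M A))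
      fun t t' h => hinj (congrArg Subtype.val h)).trans_lt h1
  · exact (mk_le_of_injective (f := fun t => (⟨p t, (hmem t).1⟩ : realizedAverages φ M κ A))
      fun t t' h => hinj (congrArg Subtype.val h)).trans_lt h1

end

/-! ### Counting isomorphism types -/

/-- If `K` has fewer than `2 ^ lam` isomorphism types, then among `2 ^ lam` models from `K` there
are `μ` many isomorphic ones, for each regular `μ ≤ 2 ^ lam`. -/
theorem exists_large_isomorphic {L : FirstOrder.Language.{v, w}} {K : Set (Model.{u} L)}
    {lam μ : Cardinal.{u}} (hK : numModels K < lift.{max (u + 1) v w} ((2 : Cardinal.{u}) ^ lam))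
    {W : Type u} (hW : #W = 2 ^ lam) (M : W → Model.{u} L) (hM : ∀ w, M w ∈ K)
    (hμ : μ.IsRegular) (hμlam : μ ≤ 2 ^ lam) :
    ∃ (S : Set W) (w₀ : W), μ ≤ #S ∧ ∀ w ∈ S, Nonempty (L.Equiv (M w) (M w₀)) := by
  obtain ⟨c, hc, hclt⟩ := Cardinal.lt_lift_iff.1 hK
  let C : Type _ := (Quotient.mk (FirstOrder.Language.equivSetoid (L := L))) '' K
  obtain ⟨e⟩ : Nonempty (C ≃ ULift.{max (u + 1) v w} c.out) := by
    refine Cardinal.eq.1 ?_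
    rw [mk_uLift, mk_out]
    exact hclt.symm
  let g : W → c.out := fun w => (e ⟨_, M w, hM w, rfl⟩).down
  have key : ∃ x, μ ≤ #(g ⁻¹' {x}) := by
    rcases hμlam.eq_or_lt with h | h
    · refine infinite_pigeonhole_card g μ (h.trans hW.symm).le hμ.aleph0_le ?_
      rw [hμ.cof_ord, mk_out, h]
      exact hc
    · have hreg := isRegular_succ (hμ.aleph0_le.trans (le_max_right c μ))
      obtain ⟨x, hx⟩ := infinite_pigeonhole_card g (Order.succ (max c μ))
        ((Order.succ_le_of_lt (max_lt hc h)).trans_eq hW.symm) hreg.aleph0_le (by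
          rw [hreg.cof_ord, mk_out]
          exact Order.lt_succ_of_le (le_max_left _ _))
      exact ⟨x, (le_max_right c μ).trans ((Order.le_succ _).trans hx)⟩
  obtain ⟨x, hx⟩ := key
  obtain ⟨w₀, hw₀⟩ : (g ⁻¹' {x}).Nonempty := by
    rw [Set.nonempty_iff_ne_empty]
    rintro h
    rw [h, mk_eq_zero] at hx
    exact (hμ.pos.trans_le hx).false
  refine ⟨_, w₀, hx, fun w hw => ?_⟩
  have h1 : g w = g w₀ := Eq.trans hw (Eq.symm hw₀)
  have h2 := e.injective (ULift.down_injective h1)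
  exact Quotient.exact (congrArg Subtype.val h2)

/-- There are at most `2 ^ (#A + |L|)` structures on `A`: a structure is a set of pairs of a symbol
and a finite sequence from `A`. -/
theorem mk_structure_le {L : FirstOrder.Language.{v, w}} (A : Type u)
    (h : ℵ₀ ≤ lift.{max v w} #A + lift.{u} L.card) :
    #(L.Structure A) ≤ 2 ^ (lift.{max v w} #A + lift.{u} L.card) := by
  let G : L.Structure A → Set (L.Symbols × List A) := fun S =>
    {p | (∃ (n : ℕ) (f : L.Functions n) (x : Fin n → A),
        p = (Sum.inl ⟨n, f⟩, S.funMap f x :: List.ofFn x)) ∨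
      ∃ (n : ℕ) (r : L.Relations n) (x : Fin n → A), S.RelMap r x ∧
        p = (Sum.inr ⟨n, r⟩, List.ofFn x)}
  have hG : Function.Injective G := by
    intro S T hST
    refine FirstOrder.Language.Structure.ext ?_ ?_
    · funext n f x
      have : (Sum.inl ⟨n, f⟩, S.funMap f x :: List.ofFn x) ∈ G T :=
        hST ▸ Or.inl ⟨n, f, x, rfl⟩
      rcases this with ⟨m, g, y, hy⟩ | ⟨m, g, y, -, hy⟩
      · simp only [Prod.mk.injEq, Sum.inl.injEq, List.cons.injEq] at hy
        obtain ⟨h1, h2, h3⟩ := hy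
        obtain ⟨rfl, h1⟩ := Sigma.mk.inj h1
        obtain rfl := eq_of_heq h1
        rw [h2, List.ofFn_injective h3]
      · simp at hy
    · have key : ∀ (S T : L.Structure A), G S = G T → ∀ (n : ℕ) (r : L.Relations n)
          (x : Fin n → A), S.RelMap r x → T.RelMap r x := by
        intro S T hST n r x hx
        have : (Sum.inr ⟨n, r⟩, List.ofFn x) ∈ G T := hST ▸ Or.inr ⟨n, r, x, hx, rfl⟩
        rcases this with ⟨m, g, y, hy⟩ | ⟨m, g, y, hy', hy⟩
        · simp at hy
        · simp only [Prod.mk.injEq, Sum.inr.injEq] at hy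
          obtain ⟨h1, h3⟩ := hy
          obtain ⟨rfl, h1⟩ := Sigma.mk.inj h1
          obtain rfl := eq_of_heq h1
          rwa [List.ofFn_injective h3]
      funext n r x
      exact propext ⟨key S T hST n r x, key T S hST.symm n r x⟩
  refine (mk_le_of_injective hG).trans ?_
  rw [mk_set, mk_prod]
  refine power_le_power_left two_ne_zero (mul_le_of_le h (self_le_add_left _ _) ?_)
  refine (lift_le.2 (mk_list_le_max A)).trans ?_
  rw [lift_max, lift_aleph0]
  exact max_le h (self_le_add_right _ _)

theorem numModels_le {L : FirstOrder.Language.{v, w}} {K : Set (Model.{u} L)} {ν : Cardinal.{u}}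
    (hK : AllOfCard K ν) : numModels K ≤ lift.{u + 1} #(L.Structure ν.out) := by
  have h : ∀ q : (Quotient.mk (FirstOrder.Language.equivSetoid (L := L))) '' K,
      ∃ S : L.Structure ν.out, q.1 = ⟦⟨ν.out, S⟩⟧ := by
    rintro ⟨_, M, hM, rfl⟩
    obtain ⟨e⟩ : Nonempty (M ≃ ν.out) := Cardinal.eq.1 (by rw [mk_out, hK M hM])
    exact ⟨e.inducedStructure, Quotient.sound ⟨e.inducedStructureEquiv⟩⟩
  choose S hS using h
  rw [← mk_uLift]
  refine mk_le_of_injective (f := fun q => ULift.up (S q)) fun q q' hqq' => Subtype.ext ?_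
  rw [hS q, hS q', ULift.up_injective hqq']

/-! ### The lower bound -/

section

variable {L : FirstOrder.Language.{v, w}} {ι : Type u} {κ lam : Cardinal.{u}}
  {K : Set (Model.{u} L)} {φ : Formula L ι}

theorem le_numModels_of_dense (hκ : κ.IsRegular) (hκlam : κ < lam) (hS : Star φ K κ lam)
    (hG : CondG ι κ lam) : lift.{max (u + 1) v w} ((2 : Cardinal.{u}) ^ lam) ≤ numModels K := by
  by_contra! hlt
  have hlam := hκ.aleph0_le.trans hκlam.le
  obtain ⟨P, hPlt, hP, hP'⟩ := hG
  obtain ⟨C, hC⟩ := exists_isCodeFamily hκ hκlam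
  have hsucc : (Order.succ κ).IsRegular ∧ κ < Order.succ κ ∧ Order.succ κ ≤ lam :=
    ⟨isRegular_succ hκ.aleph0_le, Order.lt_succ κ, Order.succ_le_of_lt hκlam⟩
  have hZ : #(WithTop lam.ord.ToType) ≤ lam := by
    rw [WithTop, mk_option, mk_ord_toType, add_one_eq hlam]
  choose M hM a ha using fun w => hS.2 (blockSum fun _ : WithTop lam.ord.ToType =>
    C w (Order.succ κ)) (hC.mk_blockSum hlam hZ w fun _ => hsucc)
  have hμ : (Order.succ (max #P lam)).IsRegular :=
    isRegular_succ (hlam.trans (le_max_right _ _))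
  obtain ⟨S, w₀, hSμ, he⟩ := exists_large_isomorphic hlt (mk_out _) M hM hμ
    (Order.succ_le_of_lt (max_lt hPlt (cantor lam)))
  have e := fun w : S => (he w.1 w.2).some
  obtain ⟨β⟩ : Nonempty (M w₀ ≃ lam.out) := Cardinal.eq.1 (by rw [mk_out, hS.1 _ (hM w₀)])
  let E : (ι → M w₀) ≃ (ι → lam.out) := Equiv.arrowCongr (Equiv.refl ι) β
  have h1 := (hC.comp (Subtype.val_injective (p := (· ∈ S)))).mk_le_of_dense hκ hκlam
    (strictRel_asymm φ (M w₀)) (fun w s i => e w (a w.1 s i))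
    (fun w => ((ha w.1).isOrderedSkeleton.equiv (e w)).isSkeleton) {p | E '' p ∈ P}
    (fun p hp => (mk_image_eq E.injective).symm.trans (hP _ hp)) (fun X hX => by
      obtain ⟨p, hp, hpX⟩ := hP' (E '' X) ((mk_image_eq E.injective).trans hX)
      refine ⟨E ⁻¹' p, ?_, fun x hx => ?_⟩
      · rw [Set.mem_ofPred_eq, Set.image_preimage_eq _ E.surjective]
        exact hp
      · obtain ⟨y, hy, hxy⟩ := hpX hx
        rwa [← E.injective hxy])
  have h2 : #{p | E '' p ∈ P} ≤ #P :=
    mk_preimage_of_injective _ _ (Set.image_injective.2 E.injective)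
  exact ((Order.succ_le_iff.1 hSμ).trans_le (h1.trans h2)).not_ge (le_max_left _ _)

/-- If `lam ^ κ < 2 ^ lam`, then the family of all subsets of size `κ` is small. -/
theorem condG_of_power_lt (hκ : κ.IsRegular) (hικ : #ι < κ) (hκlam : κ < lam)
    (h : lam ^ κ < 2 ^ lam) : CondG ι κ lam := by
  refine ⟨{p | #p = κ}, ?_, fun p hp => hp, fun X hX => ?_⟩
  · have h1 : #{p : Set (ι → lam.out) | #p = κ} ≤ #(κ.out → ι → lam.out) := by
      have : ∀ p : {p : Set (ι → lam.out) | #p = κ},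
          ∃ g : κ.out → ι → lam.out, Set.range g = p.1 := fun p => by
        obtain ⟨e⟩ : Nonempty (κ.out ≃ p.1) := Cardinal.eq.1 ((mk_out κ).trans p.2.symm)
        exact ⟨fun x => (e x).1, by
          rw [show (fun x => (e x).1) = Subtype.val ∘ e from rfl, e.surjective.range_comp,
            Subtype.range_coe]⟩
      choose g hg using this
      exact mk_le_of_injective (f := g) fun p p' hpp => Subtype.ext (by rw [← hg p, hpp, hg p'])
    refine (h1.trans ?_).trans_lt h
    simp only [← power_def, mk_out]
    rw [← power_mul, mul_comm]
    exact power_le_power_left (hκ.pos.trans hκlam).ne'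
      (mul_le_of_le hκ.aleph0_le le_rfl hικ.le)
  · obtain ⟨p, hpX, hp⟩ := le_mk_iff_exists_subset.1 (hκlam.le.trans_eq hX.symm)
    exact ⟨p, hp, hpX⟩

/-- There are at most `2 ^ #X` cuts, and a cut of large cofinality forces `κ ≤ #X`. -/
theorem power_lt_of_condF {d : Cardinal.{u}} (hκ : κ.IsRegular) (hκlam : κ < lam)
    (h : CondF d κ lam) : lam ^ κ < 2 ^ lam := by
  obtain ⟨X, _, -, hcuts, hlt⟩ := h
  have h1 : lam ≤ 2 ^ #X := (hcuts.trans (mk_set_le _)).trans_eq mk_set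
  obtain ⟨C, -, hC, -⟩ : {C : Set X | IsLowerSet C ∧ κ ≤ Order.cof C ∧
      κ ≤ Order.cof (↥Cᶜ)ᵒᵈ}.Nonempty := by
    rw [Set.nonempty_iff_ne_empty]
    rintro h0
    rw [h0, mk_eq_zero] at hcuts
    exact hcuts.not_gt (hκ.pos.trans hκlam)
  have h2 : κ ≤ #X := hC.trans ((Order.cof_le_cardinalMk _).trans (mk_set_le _))
  calc lam ^ κ ≤ (2 ^ #X) ^ κ := power_le_power_right h1
    _ = 2 ^ #X := by rw [← power_mul, mul_eq_left (hκ.aleph0_le.trans h2) h2 hκ.pos.ne']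
    _ ≤ 2 ^ (#X + d) := power_le_power_left two_ne_zero (self_le_add_right _ _)
    _ < 2 ^ lam := hlt

/-- A lower bound from sets of sequences, called good, over which the skeletons depend on fewer
than `lam` elements, if the sequences of each model are the union of an increasing `lam`-sequence of
good sets. -/
theorem le_numModels_of_filtration (hκ : κ.IsRegular) (hκlam : κ < lam) (hK : AllOfCard K lam)
    (hpow : lam ^ #ι < 2 ^ lam) (Good : ∀ M : Model.{u} L, Set (ι → M) → Prop)
    (hGood : ∀ (M N : Model.{u} L) (e : L.Equiv M N) (B : Set (ι → N)), Good N B →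
      Good M {x | (fun i => e (x i)) ∈ B})
    (hfil : ∀ M ∈ K, ∃ B : lam.ord.ToType → Set (ι → M), Monotone B ∧ (∀ x, ∃ i, x ∈ B i) ∧
      ∀ i, Good M (B i))
    (hex : ∀ (J : Type u) [LinearOrder J], #J = lam → ∃ M ∈ K, ∃ a : J → ι → M,
      IsOrderedSkeleton φ M κ a ∧ ∀ B, Good M B → ∃ S : Set J, #S < lam ∧
        ∀ c ∈ B, Determines φ M a S c) :
    lift.{max (u + 1) v w} ((2 : Cardinal.{u}) ^ lam) ≤ numModels K := by
  by_contra! hlt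
  have hlam := hκ.aleph0_le.trans hκlam.le
  obtain ⟨ρ, m, hρ, hκρ, hρlam, hm, hcov, hcase⟩ := exists_regular_cover hκ hκlam
  obtain ⟨c, hc⟩ := exists_stationaryAt_partition hκ hρ hκρ
  obtain ⟨C, hC⟩ := exists_isCodeFamily hκ hκlam
  have : Nonempty ρ.ord.ToType :=
    nonempty_of_aleph0_le_cof (hρ.aleph0_le.trans_eq (cof_ord_toType hρ).symm)
  choose M hM a ha ha' using fun w => hex (blockSum fun ζ => C w (m (c ζ)))
    (hC.mk_blockSum hlam ((mk_ord_toType ρ).trans_le hρlam) w fun _ => hm _)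
  have hμ : (Order.succ (max (lam ^ #ι) lam)).IsRegular :=
    isRegular_succ (hlam.trans (le_max_right _ _))
  obtain ⟨S, w₀, hSμ, he⟩ := exists_large_isomorphic hlt (mk_out _) M hM hμ
    (Order.succ_le_of_lt (max_lt hpow (cantor lam)))
  have e := fun w : S => (he w.1 w.2).some
  obtain ⟨B, hBmono, hBcov, hB⟩ := hfil _ (hM w₀)
  have h1 := (hC.comp (Subtype.val_injective (p := (· ∈ S)))).mk_le_of_filtration hκ
    (strictRel_asymm φ (M w₀)) hρ hκρ hρlam hm hcov hcase hc (fun w s i => e w (a w.1 s i))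
    (fun w => ((ha w.1).equiv (e w)).isSkeleton) B hBmono hBcov (fun w i => by
      obtain ⟨J, hJ, hD⟩ := ha' w.1 _ (hGood _ _ (e w) _ (hB i))
      refine ⟨J, hJ, fun x hx => Determines.dependsOn_strictRel ((determines_equiv (e w)).2
        (hD _ ?_))⟩
      simpa using hx)
  have h2 : #(ι → M w₀) = lam ^ #ι := by rw [← power_def, hK _ (hM w₀)]
  rw [h2] at h1
  exact (Order.succ_le_iff.1 hSμ).not_ge h1

theorem le_numModels_of_power_eq (hκ : κ.IsRegular) (hκlam : κ < lam) (hS : Star φ K κ lam)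
    (h : lam = lam ^ #ι) : lift.{max (u + 1) v w} ((2 : Cardinal.{u}) ^ lam) ≤ numModels K := by
  have hlam := hκ.aleph0_le.trans hκlam.le
  refine le_numModels_of_filtration (φ := φ) hκ hκlam hS.1 (h.symm.trans_lt (cantor lam))
    (fun M B => #B < lam) (fun M N e B hB => (mk_preimage_of_injective _ _
      fun x y hxy => funext fun i => e.injective (congrFun hxy i)).trans_lt hB)
    (fun M hM => ?_) fun J _ hJ => ?_
  · obtain ⟨e⟩ : Nonempty ((ι → M) ≃ lam.ord.ToType) :=
      Cardinal.eq.1 (by rw [mk_ord_toType, ← power_def, hS.1 M hM, ← h])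
    refine ⟨fun i => {x | e x ≤ i}, fun i j hij x hx => le_trans hx hij,
      fun x => ⟨e x, le_refl (e x)⟩,
      fun i => ?_⟩
    exact (mk_preimage_of_injective e (Set.Iic i) e.injective).trans_lt (mk_Iic_toType_lt hlam i)
  · obtain ⟨M, hM, a, ha⟩ := hS.2 J hJ
    refine ⟨M, hM, a, ha.isOrderedSkeleton, fun B hB => ?_⟩
    obtain ⟨T, hT, hD⟩ := ha.isOrderedSkeleton.exists_determines hκ.aleph0_le B
    exact ⟨T, hT.trans_lt (max_lt hB hκlam), hD⟩

theorem le_numModels_of_condC (hκ : κ.IsRegular) (hκlam : κ < lam) (h : CondC φ K κ lam) :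
    lift.{max (u + 1) v w} ((2 : Cardinal.{u}) ^ lam) ≤ numModels K := by
  have hlam := hκ.aleph0_le.trans hκlam.le
  obtain ⟨hK, hpow, hcof, hex⟩ := h
  refine le_numModels_of_filtration (φ := φ) hκ hκlam hK hpow
    (fun M B => ∃ A : Set M, #A < lam ∧ ∀ x ∈ B, ∀ i, x i ∈ A) (fun M N e B hB => ?_)
    (fun M hM => ?_) fun J _ hJ => ?_
  · obtain ⟨A, hA, hAB⟩ := hB
    exact ⟨e ⁻¹' A, (mk_preimage_of_injective _ _ e.injective).trans_lt hA,
      fun x hx i => hAB _ hx i⟩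
  · obtain ⟨e⟩ : Nonempty (M ≃ lam.ord.ToType) :=
      Cardinal.eq.1 (by rw [mk_ord_toType, hK M hM])
    refine ⟨fun j => {x | ∀ i, e (x i) ≤ j}, fun j j' hj x hx i => (hx i).trans hj, fun x => ?_,
      fun j => ⟨{y | e y ≤ j}, ?_, fun x hx => hx⟩⟩
    · obtain ⟨b, hb⟩ := exists_forall_lt_range (fun i => e (x i))
        (by rwa [Ordinal.cof_toType])
      exact ⟨b, fun i => (hb i).le⟩
    · exact (mk_preimage_of_injective e (Set.Iic j) e.injective).trans_lt
        (mk_Iic_toType_lt hlam j)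
  · obtain ⟨M, hM, a, ha⟩ := hex J hJ
    refine ⟨M, hM, a, ha.isOrderedSkeleton, fun B hB => ?_⟩
    obtain ⟨A, hA, hAB⟩ := hB
    obtain ⟨T, hT, hD⟩ := ha.2.2 A hA
    exact ⟨T, hT, fun x hx => hD x (hAB x hx)⟩

theorem isRegular_max_succ {c : Cardinal.{u}} (hκ : κ.IsRegular) (hκlam : κ < lam)
    (hc : c.IsRegular) (hclam : c ≤ lam) :
    (max c (Order.succ κ)).IsRegular ∧ κ < max c (Order.succ κ) ∧ max c (Order.succ κ) ≤ lam := by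
  refine ⟨?_, lt_max_of_lt_right (Order.lt_succ κ), max_le hclam (Order.succ_le_of_lt hκlam)⟩
  rcases max_choice c (Order.succ κ) with h | h <;> rw [h]
  · exact hc
  · exact isRegular_succ hκ.aleph0_le

/-- The index set has a top element, so that also an unbounded subset of `lam` of order type `κ` has
a supremum with a block above it. -/
theorem le_numModels_of_condD (hκ : κ.IsRegular) (hκlam : κ < lam) (h : CondD φ K κ lam) :
    lift.{max (u + 1) v w} ((2 : Cardinal.{u}) ^ lam) ≤ numModels K := by
  by_contra! hlt
  have hlam := hκ.aleph0_le.trans hκlam.le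
  obtain ⟨lam0, lam1, lam3, mu0, mu1, -, hlam1, -, -, -, hmu1, hreg1, hregmu, hK, -, hex, hcov⟩ := h
  obtain ⟨C, hC⟩ := exists_isCodeFamily hκ hκlam
  have hθ := isRegular_max_succ hκ hκlam hreg1 hlam1
  have hle : lam1 ≤ max lam1 (Order.succ κ) := le_max_left _ _
  generalize max lam1 (Order.succ κ) = θ at hθ hle
  have hZ : #(WithTop lam.ord.ToType) ≤ lam := by
    rw [WithTop, mk_option, mk_ord_toType, add_one_eq hlam]
  choose M hM ha hfew using fun w => hex (blockSum fun _ : WithTop lam.ord.ToType => C w θ)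
    (hC.mk_blockSum hlam hZ w fun _ => hθ)
  choose a ha using ha
  obtain ⟨S, w₀, hSμ, he⟩ := exists_large_isomorphic hlt (mk_out _) M hM hregmu hmu1
  have e := fun w : S => (he w.1 w.2).some
  obtain ⟨g⟩ : Nonempty (mu1.out ↪ S) := (mk_out mu1).trans_le hSμ
  obtain ⟨β⟩ : Nonempty (M w₀ ≃ lam3.out) := Cardinal.eq.1 (by rw [mk_out, hK _ (hM w₀)])
  let P : mu1.out → Cardinal.{u} → LinOrd.{u} := fun i => C (g i).1
  have hP : IsCodeFamily κ lam P := hC.comp (Subtype.val_injective.comp g.injective)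
  have hne : ∀ i, Nonempty (P i θ) := fun i => nonempty_of_aleph0_le_cof (by
    rw [hP.cof_eq i θ hθ.1 hθ.2.1 hθ.2.2]; exact hθ.1.aleph0_le)
  let b : ∀ i, (blockSum fun _ : WithTop lam.ord.ToType => P i θ) → ι → M w₀ :=
    fun i s j => e (g i) (a (g i).1 s j)
  have hb : ∀ i, WeaklySkeletonLike₃ φ (M w₀) κ lam0 lam1 (b i) :=
    fun i => (ha (g i).1).equiv (e (g i))
  let f : mu1.out → WithTop lam.ord.ToType → ι → lam3.out :=
    fun i ζ j => β (b i (pt _ ζ (hne i).some) j)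
  have hf : ∀ i, Function.Injective (f i) := fun i ζ ζ' h =>
    (strictMono_pt (L := fun _ : WithTop lam.ord.ToType => P i θ) fun _ => (hne i).some).injective
      ((hb i).isOrderedSkeleton.isSkeleton.injective
        (funext fun j => β.injective (congrFun h j)))
  obtain ⟨B, hB, hmu0⟩ := hcov (fun i => Set.range fun ζ : lam.ord.ToType => f i ζ)
    fun i => (mk_range_eq _ ((hf i).comp WithTop.coe_injective)).trans (mk_ord_toType _)
  refine hmu0.not_gt ?_
  have hA : #(β ⁻¹' B) < lam0 := (mk_preimage_of_injective _ _ β.injective).trans_lt hB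
  have hδ : ∀ i : {i : mu1.out | κ ≤ #{x : ι → lam3.out |
      x ∈ (Set.range fun ζ : lam.ord.ToType => f i ζ) ∧ ∀ j, x j ∈ B}},
      ∃ δ : WithTop lam.ord.ToType, Order.cof (Set.Iio δ) = κ ∧
        ∃ᶠ ζ : Set.Iio δ in Filter.atTop, ∀ j, f i.1 ζ.1 j ∈ B := by
    intro i
    let U : Set (WithTop lam.ord.ToType) := {ζ | ζ < ⊤ ∧ ∀ j, f i.1 ζ j ∈ B}
    have hU : κ ≤ #U := by
      refine i.2.trans ((mk_le_mk_of_subset ?_).trans (mk_image_le (f := f i.1)))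
      rintro _ ⟨⟨ζ, rfl⟩, h⟩
      exact ⟨ζ, ⟨WithTop.coe_lt_top _, h⟩, rfl⟩
    obtain ⟨δ, h1, h2, -⟩ := exists_cof_eq_of_le_mk hκ hU fun ζ hζ => hζ.1
    exact ⟨δ, h1, h2.mono fun ζ hζ => hζ.2⟩
  choose δ hδ hfr using hδ
  exact (hP.comp Subtype.val_injective).mk_lt_of_fewTypes hκ (hfew w₀) hA (fun _ _ => θ)
    (fun _ _ => hθ) (fun i => b i.1) (fun i => (hb i.1).isOrderedSkeleton)
    (fun i _ => (hne i.1).some) δ hδ hfr fun i =>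
      let ⟨J, hJ, hD⟩ := (hb i.1).2.2 _ hA
      ⟨J, hJ.trans_le hle, hD⟩

/-- The upper cofinality at `ζ` is `max (h α ζ) κ⁺` instead of `h α ζ`, because a block codes `α`
only if its cofinality is larger than `κ`. -/
theorem le_numModels_of_condE (hκ : κ.IsRegular) (hκlam : κ < lam) (h : CondE φ K κ lam) :
    lift.{max (u + 1) v w} ((2 : Cardinal.{u}) ^ lam) ≤ numModels K := by
  by_contra! hlt
  have hlam := hκ.aleph0_le.trans hκlam.le
  obtain ⟨E, lam0, lam1, mu0, lam3, mu1, -, -, hmu1, hregmu, hK, -, hex, h, hh, hcov⟩ := h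
  obtain ⟨C, hC⟩ := exists_isCodeFamily hκ hκlam
  have hθ := fun α ζ => isRegular_max_succ hκ hκlam (hh α ζ).1 (hh α ζ).2.2
  obtain ⟨x₀, -⟩ := exists_mk_Iio_eq hκlam
  have : Nonempty lam.ord.ToType := ⟨x₀⟩
  choose M hM ha hfew using fun α => hex (blockSum fun ζ => C α (max (h α ζ) (Order.succ κ)))
    (hC.mk_blockSum hlam (mk_ord_toType lam).le α (hθ α))
  choose a ha using ha
  obtain ⟨S, w₀, hSμ, he⟩ := exists_large_isomorphic hlt (mk_out _) M hM hregmu hmu1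
  have e := fun w : S => (he w.1 w.2).some
  obtain ⟨β⟩ : Nonempty (M w₀ ≃ lam3.out) := Cardinal.eq.1 (by rw [mk_out, hK _ (hM w₀)])
  have hne : ∀ α ζ, Nonempty (C α (max (h α ζ) (Order.succ κ))) := fun α ζ =>
    nonempty_of_aleph0_le_cof (by
      rw [hC.cof_eq _ _ (hθ α ζ).1 (hθ α ζ).2.1 (hθ α ζ).2.2]; exact (hθ α ζ).1.aleph0_le)
  let b : ∀ α : S, (blockSum fun ζ => C α.1 (max (h α.1 ζ) (Order.succ κ))) → ι → M w₀ :=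
    fun α s j => e α (a α.1 s j)
  have hb : ∀ (α : S) ε, WeaklySkeletonLike₃ φ (M w₀) κ (lam0 ε) (lam1 ε) (b α) :=
    fun α ε => (ha α.1 ε).equiv (e α)
  obtain ⟨ε, B, hB, hmu0⟩ := hcov S hSμ fun α ζ j => β (b α (pt _ ζ (hne α.1 ζ).some) j)
  refine hmu0.not_gt ?_
  have hA : #(β ⁻¹' B) < lam0 ε := (mk_preimage_of_injective _ _ β.injective).trans_lt hB
  choose δ hlim hδ hle using fun α : {α : S | ∃ δ : lam.ord.ToType,
      IsLimitPoint {ζ | ∀ j, β (b α (pt _ ζ (hne α.1 ζ).some) j) ∈ B} δ ∧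
        Order.cof (Set.Iio δ) = κ ∧ lam1 ε ≤ h α δ} => α.2
  refine (hC.comp (Subtype.val_injective.comp Subtype.val_injective)).mk_lt_of_fewTypes hκ
    (hfew w₀ ε) hA (fun α ζ => max (h α.1.1 ζ) (Order.succ κ)) (fun α => hθ α.1.1)
    (fun α => b α.1) (fun α => (hb α.1 ε).isOrderedSkeleton) (fun α ζ => (hne α.1.1 ζ).some) δ hδ
    (fun α => ?_) fun α => ?_
  · have := nonempty_of_aleph0_le_cof (hκ.aleph0_le.trans_eq (hδ α).symm)
    refine Filter.frequently_atTop.2 fun ζ => ?_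
    obtain ⟨ξ, h1, h2, h3⟩ := (hlim α).2 ζ.1 ζ.2
    exact ⟨⟨ξ, h3⟩, h2.le, h1⟩
  · obtain ⟨J, hJ, hD⟩ := (hb α.1 ε).2.2 _ hA
    exact ⟨J, hJ.trans_le ((hle α).trans (le_max_left _ _)), hD⟩

end

end Skel

theorem theorem3p11 {L : FirstOrder.Language.{v, w}} {ι : Type u} (κ lam : Cardinal.{u})
    (hικ : #ι < κ) (hκ : κ.IsRegular) (hκlam : κ < lam)
    (K : Set (Skel.Model.{u} L)) (φ : Skel.Formula L ι)
    (h : (Skel.Star φ K κ lam ∧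
            (lam = lam ^ #ι ∨ lam ^ κ < 2 ^ lam ∨ Skel.CondF #ι κ lam ∨ Skel.CondG ι κ lam)) ∨
          Skel.CondC φ K κ lam ∨ Skel.CondD φ K κ lam ∨ Skel.CondE φ K κ lam) :
    Cardinal.lift.{max (u + 1) v w} ((2 : Cardinal.{u}) ^ lam) ≤ Skel.numModels K ∧
    ∀ ν : Cardinal.{u}, Skel.AllOfCard K ν →
      (2 : Cardinal.{max u v w}) ^ (Cardinal.lift.{max v w} ν + Cardinal.lift.{u} L.card) =
        Cardinal.lift.{max v w} ((2 : Cardinal.{u}) ^ lam) →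
      Skel.numModels K = Cardinal.lift.{max (u + 1) v w} ((2 : Cardinal.{u}) ^ lam) := by
  have hlow : Cardinal.lift.{max (u + 1) v w} ((2 : Cardinal.{u}) ^ lam) ≤ Skel.numModels K := by
    rcases h with ⟨hS, h | h | h | h⟩ | h | h | h
    · exact Skel.le_numModels_of_power_eq hκ hκlam hS h
    · exact Skel.le_numModels_of_dense hκ hκlam hS (Skel.condG_of_power_lt hκ hικ hκlam h)
    · exact Skel.le_numModels_of_dense hκ hκlam hS
        (Skel.condG_of_power_lt hκ hικ hκlam (Skel.power_lt_of_condF hκ hκlam h))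
    · exact Skel.le_numModels_of_dense hκ hκlam hS h
    · exact Skel.le_numModels_of_condC hκ hκlam h
    · exact Skel.le_numModels_of_condD hκ hκlam h
    · exact Skel.le_numModels_of_condE hκ hκlam h
  refine ⟨hlow, fun ν hν hpow => le_antisymm ?_ hlow⟩
  have hlam := hκ.aleph0_le.trans hκlam.le
  have hinf : ℵ₀ ≤ lift.{max v w} ν + lift.{u} L.card := by
    by_contra! hfin
    have h1 := power_lt_aleph0 (natCast_lt_aleph0 (n := 2)) hfin
    rw [Nat.cast_ofNat, hpow, lift_lt_aleph0] at h1
    exact (hlam.trans (cantor lam).le).not_gt h1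
  have h1 := Skel.mk_structure_le (L := L) ν.out (by rwa [mk_out])
  rw [mk_out, hpow] at h1
  calc Skel.numModels K ≤ lift.{u + 1} #(L.Structure ν.out) := Skel.numModels_le hν
    _ ≤ lift.{u + 1} (lift.{max v w} ((2 : Cardinal.{u}) ^ lam)) := lift_le.2 h1
    _ = lift.{max (u + 1) v w} ((2 : Cardinal.{u}) ^ lam) := by rw [lift_lift]
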